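/- **Setting.** Let $W\in\mathbb R^{s\times m}$, $q\in\mathbb R^m$, $\varphi(t)=\min\{q^\top y: Wy=t,\ y\ge 0\}$ for $t\in\mathbb R^s$ (Euclidean norm throughout), and let $\mu$ be a Borel probability measure on $\mathbb R^s$. For $x\in\mathbb R^s$, $\eta\in\mathbb R$ and $\alpha\in(0,1)$ put $$Q_{EE}(x,\eta)=\int \max\{0,\varphi(z-x)-\eta\}\,\mu(dz),\qquad Q_{\alpha VaR}(x)=\inf\{t\in\mathbb R: \mu(\{z:\varphi(z-x)\le t\})\ge 1-\alpha\},$$ $$Q_{\alpha CVaR}(x)=\min_{\eta\in\mathbb R}\{\eta+\tfrac1\alpha Q_{EE}(x,\eta)\}.$$ A function $f$ is $\kappa$-strongly convex on a convex set $V$ if $f(\lambda x+(1-\lambda)y)\le\lambda f(x)+(1-\lambda)f(y)-\frac\kappa2\lambda(1-\lambda)\|x-y\|^2$ for all $x,y\in V$, $\lambda\in(0,1)$. Let $d_i$ ($i\in I$) be the extreme points of $\{v: W^\top v\le q\}$, and let $K_i=\{z:(d_i-d_j)^\top z\ge0\ \forall j\in I\}$, $K_i^+=K_i\cap\{z:d_i^\top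 z\ge0\}$, $I^+=\{i\in I:\operatorname{int}K_i^+\ne\emptyset,\ d_i\neq0\}$. For $\eta>0$ and $i\in I^+$ let $\hat y^i(\eta)$ be a point of minimal norm among the intersection points of the hyperplane $\{z:d_i^\top z=\eta\}$ with the extreme rays of $K_i$, and let $\gamma_i=d_i^\top t^i$, where $t^i$ is the unit vector spanning the extreme ray through $\hat y^i(\eta)$. Let $I^{\pm}$ be the set of $i\in I^+$ such that $K_i\cap\{z:d_i^\top z\ge\eta\}$ and $K_i\cap\{z:d_i^\top z\le\eta\}$ are both unbounded ($\eta>0$), and $I^{++}$ the set of $i\in I^+$ such that only the first one is unbounded. **Assumptions.** * A1: for every $t\in\mathbb R^s$ there is $y\ge0$ with $Wy=t$. * A2: there is $v$ with $W^\top v<q$ (componentwise). * A3: $\int\|z\|\,\mu(dz)<\infty$. * A4: $\mu$ has a Lebesgue density $\theta$, $V\subseteq\mathbb R^s$ is convex and open, $r,\rho>0$, and $\theta\ge r$ almost everywhere on $V+B_\rho(0)$. * A5: $\eta_0>0$ and $\|\hat y^i(\eta_0)\|<\rho$ for all $i\in I^+$. Let $\delta=\max\{\alpha'_i,\gamma'_j: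 i\in I^{++},\ j\in I^{\pm}\}$, where $\alpha'_i>0$ are any constants with $d_i^\top u\ge\alpha'_i\|u\|$ for all $u\in K_i$, and $\gamma'_j$ are any constants with $0<\gamma'_j<\gamma_j$ (for example $\gamma'_j=\gamma_j/2$). Call $\kappa$ a *modulus of restricted partial strong convexity of $Q_{EE}$ for $\eta\le\eta_0$* if, for every set $\Omega\subseteq V\times(-\infty,\eta_0]$ such that $\eta'-\eta\ge-\frac\delta3\|y-x\|$ whenever $(x,\eta),(y,\eta')\in\Omega$ and $y-x\in K_i$ for some $i\in I^+$, one has $$Q_{EE}(\lambda p_1+(1-\lambda)p_2)\le\lambda Q_{EE}(p_1)+(1-\lambda)Q_{EE}(p_2)-\tfrac\kappa2\lambda(1-\lambda)\|x_1-x_2\|^2$$ for all $p_1=(x_1,\eta_1),\ p_2=(x_2,\eta_2)\in\Omega$ and $0<\lambda<1$. **Proposition.** Assume A1, A2, A5 and let $\delta$ be as above. There is a constant $\kappa>0$, depending only on $W,q,r,\rho,\eta_0,\delta$, such that for all $V$ and $\mu$ satisfying A3 and A4 (with these $r$ and $\rho$), $\kappa$ is a modulus of restricted partial strong convexity of $Q_{EE}$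 for $\eta\le\eta_0$, and for every $\alpha\in(0,1)$ with $$\sup_{x\in V}Q_{\alpha VaR}(x)\le\eta_0\qquad\text{and}\qquad |Q_{\alpha VaR}(y)-Q_{\alpha VaR}(x)|\le\tfrac\delta3\|y-x\|\quad\text{for all }x,y\in V,$$ the function $Q_{\alpha CVaR}$ is $\frac\kappa\alpha$-strongly convex on $V$. Moreover, for each such $V,\mu,\alpha$, $Q_{\alpha CVaR}$ is $\frac{\kappa'}\alpha$-strongly convex on $V$ for every modulus $\kappa'$ of restricted partial strong convexity of $Q_{EE}$ for $\eta\le\eta_0$. -/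

import Mathlib

open MeasureTheory
open scoped Pointwise Matrix ENNReal

noncomputable section

namespace TwoStage

/-- The space `ℝ^s` with its Euclidean norm. -/
abbrev E (s : ℕ) : Type := EuclideanSpace ℝ (Fin s)

variable {s m : ℕ}

/-! ### Recourse problem -/

/-- The feasible set `{y | W y = t, y ≥ 0}` of the second stage. -/
def feasible (W : Matrix (Fin s) (Fin m) ℝ) (t : E s) : Set (Fin m → ℝ) :=
  {y | W *ᵥ y = t.ofLp ∧ ∀ j, 0 ≤ y j}

/-- The recourse function `φ(t) = min {qᵀ y | W y = t, y ≥ 0}`. The minimum is attained under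
complete and sufficiently expensive recourse. -/
def phi (W : Matrix (Fin s) (Fin m) ℝ) (q : Fin m → ℝ) (t : E s) : ℝ :=
  sInf ((fun y => q ⬝ᵥ y) '' feasible W t)

/-- A1, complete recourse. -/
def CompleteRecourse (W : Matrix (Fin s) (Fin m) ℝ) : Prop :=
  ∀ t : E s, ∃ y : Fin m → ℝ, (∀ j, 0 ≤ y j) ∧ W *ᵥ y = t.ofLp

/-- A2, strengthened sufficiently expensive recourse: `Wᵀ v < q` for some `v`. -/
def ExpensiveRecourse (W : Matrix (Fin s) (Fin m) ℝ) (q : Fin m → ℝ) : Prop :=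
  ∃ v : E s, ∀ j, (Wᵀ *ᵥ v.ofLp) j < q j

/-! ### Geometry of the dual polyhedron

The index set `I` is replaced by the set `{d_i | i ∈ I}` of extreme points itself. -/

/-- The dual polyhedron `{v | Wᵀ v ≤ q}`. -/
def dualPolyhedron (W : Matrix (Fin s) (Fin m) ℝ) (q : Fin m → ℝ) : Set (E s) :=
  {v | ∀ j, (Wᵀ *ᵥ v.ofLp) j ≤ q j}

/-- The extreme points `d_i`, `i ∈ I`, of the dual polyhedron. -/
def vertices (W : Matrix (Fin s) (Fin m) ℝ) (q : Fin m → ℝ) : Set (E s) :=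
  (dualPolyhedron W q).extremePoints ℝ

/-- The cone `K_i = {z | (d_i - d_j)ᵀ z ≥ 0 for all j ∈ I}`, for `d = d_i`. -/
def linCone (W : Matrix (Fin s) (Fin m) ℝ) (q : Fin m → ℝ) (d : E s) : Set (E s) :=
  {z | ∀ e ∈ vertices W q, 0 ≤ inner ℝ (d - e) z}

/-- The cone `K_i⁺ = K_i ∩ {z | d_iᵀ z ≥ 0}`. -/
def linConePos (W : Matrix (Fin s) (Fin m) ℝ) (q : Fin m → ℝ) (d : E s) : Set (E s) :=
  linCone W q d ∩ {z | 0 ≤ inner ℝ d z}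

/-- `I⁺`: the `d_i ≠ 0` for which `K_i⁺` has nonempty interior. -/
def IPlus (W : Matrix (Fin s) (Fin m) ℝ) (q : Fin m → ℝ) : Set (E s) :=
  {d | d ∈ vertices W q ∧ (interior (linConePos W q d)).Nonempty ∧ d ≠ 0}

/-- The ray `{c t | c ≥ 0}`. -/
def ray (t : E s) : Set (E s) := {z | ∃ c : ℝ, 0 ≤ c ∧ z = c • t}

/-- `t ≠ 0` spans an extreme ray (one-dimensional face) of `K`. -/
def SpansExtremeRay (K : Set (E s)) (t : E s) : Prop :=
  t ≠ 0 ∧ IsExtreme ℝ K (ray t)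

/-- The points where the hyperplane `{z | d_iᵀ z = η}` meets extreme rays of `K_i`. -/
def rayPoints (W : Matrix (Fin s) (Fin m) ℝ) (q : Fin m → ℝ) (d : E s) (η : ℝ) : Set (E s) :=
  {y | inner ℝ d y = η ∧ ∃ t, SpansExtremeRay (linCone W q d) t ∧ y ∈ ray t}

/-- `y` is a point `ŷ^i(η)`: an element of minimal norm of `rayPoints`. -/
def IsYHat (W : Matrix (Fin s) (Fin m) ℝ) (q : Fin m → ℝ) (d : E s) (η : ℝ) (y : E s) : Prop :=
  y ∈ rayPoints W q d η ∧ ∀ y' ∈ rayPoints W q d η, ‖y‖ ≤ ‖y'‖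

/-- A5: `‖ŷ^i(η₀)‖ < ρ` for all `i ∈ I⁺`. -/
def ThresholdCondition (W : Matrix (Fin s) (Fin m) ℝ) (q : Fin m → ℝ) (η₀ ρ : ℝ) : Prop :=
  ∀ d ∈ IPlus W q, ∃ y, IsYHat W q d η₀ y ∧ ‖y‖ < ρ

/-- `K_i ∩ {z | d_iᵀ z ≥ η}`. -/
def cutAbove (W : Matrix (Fin s) (Fin m) ℝ) (q : Fin m → ℝ) (d : E s) (η : ℝ) : Set (E s) :=
  linCone W q d ∩ {z | η ≤ inner ℝ d z}

/-- `K_i ∩ {z | d_iᵀ z ≤ η}`. -/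
def cutBelow (W : Matrix (Fin s) (Fin m) ℝ) (q : Fin m → ℝ) (d : E s) (η : ℝ) : Set (E s) :=
  linCone W q d ∩ {z | inner ℝ d z ≤ η}

/-- `I^±`: the `i ∈ I⁺` for which both parts of `K_i` cut by `{d_iᵀ z = η}`, `η > 0`, are
unbounded. -/
def IPlusMinus (W : Matrix (Fin s) (Fin m) ℝ) (q : Fin m → ℝ) : Set (E s) :=
  {d | d ∈ IPlus W q ∧ ∀ η : ℝ, 0 < η →
    ¬ Bornology.IsBounded (cutAbove W q d η) ∧ ¬ Bornology.IsBounded (cutBelow W q d η)}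

/-- `I^{++}`: the `i ∈ I⁺` for which only the upper part is unbounded. -/
def IPlusPlus (W : Matrix (Fin s) (Fin m) ℝ) (q : Fin m → ℝ) : Set (E s) :=
  {d | d ∈ IPlus W q ∧ ∀ η : ℝ, 0 < η →
    ¬ Bornology.IsBounded (cutAbove W q d η) ∧ Bornology.IsBounded (cutBelow W q d η)}

/-- `g` is the number `γ_i = d_iᵀ t^i`, where `t^i` is the unit vector that spans an extreme ray
of `K_i` containing a point `ŷ^i(η)`, `η > 0`. -/
def IsGamma (W : Matrix (Fin s) (Fin m) ℝ) (q : Fin m → ℝ) (d : E s) (g : ℝ) : Prop :=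
  ∃ (η : ℝ) (y t : E s), 0 < η ∧ IsYHat W q d η y ∧ ‖t‖ = 1 ∧
    SpansExtremeRay (linCone W q d) t ∧ y ∈ ray t ∧ g = inner ℝ d t

/-- `δ = max {α'_i, γ'_j | i ∈ I^{++}, j ∈ I^±}` for some choice of constants `α'_i > 0` with
`d_iᵀ u ≥ α'_i ‖u‖` on `K_i` and of constants `0 < γ'_j < γ_j`. -/
def IsDelta (W : Matrix (Fin s) (Fin m) ℝ) (q : Fin m → ℝ) (δ : ℝ) : Prop :=
  ∃ a c : E s → ℝ,
    (∀ d ∈ IPlusPlus W q, 0 < a d ∧ ∀ u ∈ linCone W q d, a d * ‖u‖ ≤ inner ℝ d u) ∧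
    (∀ d ∈ IPlusMinus W q, 0 < c d ∧ ∃ g, IsGamma W q d g ∧ c d < g) ∧
    IsGreatest (a '' IPlusPlus W q ∪ c '' IPlusMinus W q) δ

/-! ### Distribution of the random vector and risk functionals -/

/-- A4 (apart from convexity and openness of `V`): `μ` has a Lebesgue density which is almost
everywhere at least `r` on `V + B_ρ(0)`. -/
def DensityCondition (μ : Measure (E s)) (V : Set (E s)) (r ρ : ℝ) : Prop :=
  ∃ θ : E s → ℝ≥0∞, Measurable θ ∧ μ = volume.withDensity θ ∧
    ∀ᵐ z ∂(volume.restrict (V + Metric.ball (0 : E s) ρ)), ENNReal.ofReal r ≤ θ z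

/-- The expected excess `Q_EE(x, η) = ∫ max {0, φ(z - x) - η} μ(dz)`. -/
def QEE (W : Matrix (Fin s) (Fin m) ℝ) (q : Fin m → ℝ) (μ : Measure (E s)) (p : E s × ℝ) : ℝ :=
  ∫ z, max 0 (phi W q (z - p.1) - p.2) ∂μ

/-- The value-at-risk `Q_{αVaR}(x) = inf {t | μ {z | φ(z - x) ≤ t} ≥ 1 - α}`. -/
def QVaR (W : Matrix (Fin s) (Fin m) ℝ) (q : Fin m → ℝ) (μ : Measure (E s)) (α : ℝ)
    (x : E s) : ℝ :=
  sInf {t : ℝ | 1 - α ≤ μ.real {z | phi W q (z - x) ≤ t}}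

/-- The conditional value-at-risk `Q_{αCVaR}(x) = min_η {η + Q_EE(x, η) / α}`. -/
def QCVaR (W : Matrix (Fin s) (Fin m) ℝ) (q : Fin m → ℝ) (μ : Measure (E s)) (α : ℝ)
    (x : E s) : ℝ :=
  ⨅ η : ℝ, (η + 1 / α * QEE W q μ (x, η))

/-! ### Restricted partial strong convexity -/

/-- `f` is restricted partially `κ`-strongly convex on `Ω` with respect to its first argument. -/
def RestrictedPartiallyStronglyConvexOn (Ω : Set (E s × ℝ)) (κ : ℝ) (f : E s × ℝ → ℝ) : Prop :=
  ∀ p₁ ∈ Ω, ∀ p₂ ∈ Ω, ∀ l : ℝ, 0 < l → l < 1 →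
    f (l • p₁ + (1 - l) • p₂) ≤
      l * f p₁ + (1 - l) * f p₂ - κ / 2 * l * (1 - l) * ‖p₁.1 - p₂.1‖ ^ 2

/-- `Ω ⊆ V × (-∞, η₀]`, and any two points `(x, η)`, `(y, η')` of `Ω` with `y - x ∈ K_i`,
`i ∈ I⁺`, satisfy `η' - η ≥ -(δ/3) ‖y - x‖`. -/
def IsAdmissible (W : Matrix (Fin s) (Fin m) ℝ) (q : Fin m → ℝ) (V : Set (E s)) (η₀ δ : ℝ)
    (Ω : Set (E s × ℝ)) : Prop :=
  Ω ⊆ V ×ˢ Set.Iic η₀ ∧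
    ∀ p ∈ Ω, ∀ p' ∈ Ω, ∀ d ∈ IPlus W q, p'.1 - p.1 ∈ linCone W q d →
      -(δ / 3) * ‖p'.1 - p.1‖ ≤ p'.2 - p.2

/-- `κ` is a modulus of restricted partial strong convexity of `Q_EE` for thresholds `η ≤ η₀`:
`Q_EE` is restricted partially `κ`-strongly convex on every admissible `Ω`. -/
def IsPartialModulus (W : Matrix (Fin s) (Fin m) ℝ) (q : Fin m → ℝ) (μ : Measure (E s))
    (V : Set (E s)) (η₀ δ κ : ℝ) : Prop :=
  ∀ Ω, IsAdmissible W q V η₀ δ Ω → RestrictedPartiallyStronglyConvexOn Ω κ (QEE W q μ)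

end TwoStage

end

noncomputable section

namespace TwoStage

variable {s m : ℕ}

/-! By duality `phi` is the support function of the compact polyhedron {v : Wᵀv ≤ q}, hence
sublinear and Lipschitz. It is linear on each K_i, and A2 gives the polyhedron interior, so φ(u) +
φ(-u) ≥ ω > 0 for all unit vectors u.

The core is a quadratic lower bound for second differences. Take a step ε in direction (u, τ) with
‖u‖ = 1. The second difference of max {0, φ(z - x) - η} is nonnegative by convexity. By the density
bound, that of Q_EE is at least r times the integral over the ball of radius ρ of the second
difference of (z, η) ↦ max {0, φ(z) - η}. By Fubini this reduces to one-dimensional integrals along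
lines parallel to u, and those must be at least a constant times ε². On a line above the threshold
the integral is controlled by the total increase of slope. Where the line crosses the threshold
upwards faster than -τ, the kink of the maximum contributes as well.

Let t be the unit vector of the ray through a suitable ŷ^i(η₀). Then φ(t) ≥ δ, the ray passes level
η₀ inside the ball, and φ is affine near t in no direction transversal to t. Fix μ < φ(t) above δ/3
and η₀/ρ. If φ(u) or φ(-u) is at least μ, lines near the origin rise above η₀ inside the ball
(`exists_lower_bound_of_steep`). Otherwise u is not ±t, and the kink of φ around a multiple of t,
where φ exceeds η₀, gives the bound, uniformly by compactness (`exists_lower_bound_of_kink`). The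
constraint on τ matters only in the first case, and admissibility supplies it because the cones K_i,
i ∈ I⁺, cover {φ > 0}.

A local midpoint argument turns second differences into strong convexity on segments
(`QEE_segment_le`). For the CVaR, the VaR is a minimizer in η, the graph of the VaR over V is
admissible, and minimizing over η preserves the inequality. -/

/-! ### Linear programming duality for the recourse function. -/

theorem inner_eq_dotProduct (v t : E s) : inner ℝ v t = v.ofLp ⬝ᵥ t.ofLp := by
  rw [EuclideanSpace.inner_eq_star_dotProduct, dotProduct_comm]
  simp

/-- Weak duality. -/
theorem inner_le_of_feasible {W : Matrix (Fin s) (Fin m) ℝ} {q : Fin m → ℝ} {v t : E s}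
    {y : Fin m → ℝ} (hv : v ∈ dualPolyhedron W q) (hy : y ∈ feasible W t) :
    inner ℝ v t ≤ q ⬝ᵥ y := by
  rw [inner_eq_dotProduct, ← hy.1, Matrix.dotProduct_mulVec, ← Matrix.mulVec_transpose]
  exact Finset.sum_le_sum fun j _ => mul_le_mul_of_nonneg_right (hv j) (hy.2 j)

theorem bddBelow_costs {W : Matrix (Fin s) (Fin m) ℝ} {q : Fin m → ℝ} {v : E s}
    (hv : v ∈ dualPolyhedron W q) (t : E s) :
    BddBelow ((fun y => q ⬝ᵥ y) '' feasible W t) :=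
  ⟨inner ℝ v t, by rintro _ ⟨y, hy, rfl⟩; exact inner_le_of_feasible hv hy⟩

theorem CompleteRecourse.nonempty {W : Matrix (Fin s) (Fin m) ℝ} (h : CompleteRecourse W)
    (t : E s) : (feasible W t).Nonempty := by
  obtain ⟨y, h0, h1⟩ := h t
  exact ⟨y, h1, h0⟩

theorem inner_le_phi {W : Matrix (Fin s) (Fin m) ℝ} (q : Fin m → ℝ) (h1 : CompleteRecourse W)
    {v : E s} (hv : v ∈ dualPolyhedron W q) (t : E s) : inner ℝ v t ≤ phi W q t :=
  le_csInf ((h1.nonempty t).image _) (by rintro _ ⟨y, hy, rfl⟩; exact inner_le_of_feasible hv hy)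

theorem ExpensiveRecourse.nonempty {W : Matrix (Fin s) (Fin m) ℝ} {q : Fin m → ℝ}
    (h : ExpensiveRecourse W q) : (dualPolyhedron W q).Nonempty := by
  obtain ⟨v, hv⟩ := h
  exact ⟨v, fun j => (hv j).le⟩

section Recourse

variable {W : Matrix (Fin s) (Fin m) ℝ} {q : Fin m → ℝ}

theorem phi_add_le (h1 : CompleteRecourse W) (h2 : ExpensiveRecourse W q) (x y : E s) :
    phi W q (x + y) ≤ phi W q x + phi W q y := by
  obtain ⟨v, hv⟩ := h2.nonempty
  refine le_of_forall_pos_le_add fun ε hε => ?_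
  obtain ⟨_, ⟨a, ha, rfl⟩, ha'⟩ := exists_lt_of_csInf_lt ((h1.nonempty x).image (fun y => q ⬝ᵥ y))
    (lt_add_of_pos_right _ (half_pos hε))
  obtain ⟨_, ⟨b, hb, rfl⟩, hb'⟩ := exists_lt_of_csInf_lt ((h1.nonempty y).image (fun y => q ⬝ᵥ y))
    (lt_add_of_pos_right _ (half_pos hε))
  have : phi W q (x + y) ≤ q ⬝ᵥ (a + b) := by
    refine csInf_le (bddBelow_costs hv _) ⟨a + b, ⟨?_, fun j => add_nonneg (ha.2 j) (hb.2 j)⟩, rfl⟩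
    rw [Matrix.mulVec_add, ha.1, hb.1]
    rfl
  rw [dotProduct_add] at this
  simp only at ha' hb'
  unfold phi at *
  linarith

theorem phi_smul_le (h1 : CompleteRecourse W) (h2 : ExpensiveRecourse W q) {c : ℝ} (hc : 0 < c)
    (x : E s) : phi W q (c • x) ≤ c * phi W q x := by
  obtain ⟨v, hv⟩ := h2.nonempty
  rw [← div_le_iff₀' hc]
  refine le_csInf ((h1.nonempty x).image _) ?_
  rintro _ ⟨y, hy, rfl⟩
  rw [div_le_iff₀' hc]
  refine csInf_le (bddBelow_costs hv _) ⟨c • y, ⟨?_, fun j => mul_nonneg hc.le (hy.2 j)⟩, ?_⟩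
  · rw [Matrix.mulVec_smul, hy.1]
    rfl
  · simp [dotProduct_smul]

theorem phi_smul_of_pos (h1 : CompleteRecourse W) (h2 : ExpensiveRecourse W q) {c : ℝ}
    (hc : 0 < c) (x : E s) : phi W q (c • x) = c * phi W q x := by
  refine le_antisymm (phi_smul_le h1 h2 hc x) ?_
  have := phi_smul_le h1 h2 (inv_pos.2 hc) (c • x)
  rw [smul_smul, inv_mul_cancel₀ hc.ne', one_smul] at this
  rwa [← div_eq_inv_mul, le_div_iff₀' hc] at this

theorem phi_zero (h1 : CompleteRecourse W) (h2 : ExpensiveRecourse W q) :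
    phi W q 0 = 0 := by
  have := phi_smul_of_pos h1 h2 (c := 2) two_pos 0
  rw [smul_zero] at this
  linarith

theorem phi_smul (h1 : CompleteRecourse W) (h2 : ExpensiveRecourse W q) {c : ℝ}
    (hc : 0 ≤ c) (x : E s) : phi W q (c • x) = c * phi W q x := by
  rcases hc.eq_or_lt with rfl | hc
  · simp [phi_zero h1 h2]
  · exact phi_smul_of_pos h1 h2 hc x

theorem phi_le_of_feasible (h2 : ExpensiveRecourse W q) {t : E s} {y : Fin m → ℝ}
    (hy : y ∈ feasible W t) : phi W q t ≤ q ⬝ᵥ y := by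
  obtain ⟨v, hv⟩ := h2.nonempty
  exact csInf_le (bddBelow_costs hv _) ⟨y, hy, rfl⟩

/-- A linear functional dominated by `phi` is given by a point of the dual polyhedron. -/
theorem mem_dualPolyhedron_of_le_phi (h2 : ExpensiveRecourse W q) {v : E s}
    (hv : ∀ t, inner ℝ v t ≤ phi W q t) : v ∈ dualPolyhedron W q := by
  intro j
  -- Test the functional on the j-th column of W, which is reached at cost q_j.
  have hy : (Pi.single j 1 : Fin m → ℝ) ∈
      feasible W (WithLp.toLp 2 (W *ᵥ Pi.single j 1) : E s) := by
    refine ⟨rfl, fun k => ?_⟩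
    by_cases h : k = j
    · subst h; simp
    · simp [h]
  have := (hv _).trans (phi_le_of_feasible h2 hy)
  rw [inner_eq_dotProduct] at this
  simp only [Matrix.dotProduct_mulVec, ← Matrix.mulVec_transpose, dotProduct_single, mul_one]
    at this
  exact this

/-- Strong duality. -/
theorem exists_dual_eq_phi (h1 : CompleteRecourse W) (h2 : ExpensiveRecourse W q) (t : E s) :
    ∃ v ∈ dualPolyhedron W q, inner ℝ v t = phi W q t := by
  by_cases ht : t = 0
  · obtain ⟨v, hv⟩ := h2.nonempty
    exact ⟨v, hv, by simp [ht, phi_zero h1 h2]⟩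
  -- Hahn–Banach: extend c • t ↦ c φ(t) from the span of t under the sublinear majorant φ. For c < 0
  -- domination follows from 0 = φ(0) ≤ φ(ct) + φ(-ct).
  obtain ⟨g, hg, hle⟩ := exists_extension_of_le_sublinear
    (LinearPMap.mkSpanSingleton (σ := RingHom.id ℝ) t (phi W q t) ht) (phi W q)
    (fun c hc x => phi_smul_of_pos h1 h2 hc x) (phi_add_le h1 h2) (by
      rintro ⟨x, hx⟩
      obtain ⟨c, rfl⟩ := Submodule.mem_span_singleton.1 hx
      rw [LinearPMap.mkSpanSingleton'_apply]
      simp only [smul_eq_mul, RingHom.id_apply]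
      rcases le_total 0 c with hc | hc
      · rw [phi_smul h1 h2 hc]
      · have e1 := phi_smul h1 h2 (neg_nonneg.2 hc) t
        have e2 := phi_add_le h1 h2 (c • t) (-c • t)
        rw [← add_smul, add_neg_cancel, zero_smul, phi_zero h1 h2, e1] at e2
        linarith)
  let v : E s := (InnerProductSpace.toDual ℝ (E s)).symm (LinearMap.toContinuousLinearMap g)
  have hv : ∀ x, inner ℝ v x = g x := fun x => by
    simp [v]
  refine ⟨v, mem_dualPolyhedron_of_le_phi h2 fun x => (hv x).trans_le (hle x), ?_⟩
  rw [hv]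
  have hm : t ∈ (LinearPMap.mkSpanSingleton (σ := RingHom.id ℝ) t (phi W q t) ht).domain :=
    Submodule.mem_span_singleton_self t
  exact (hg ⟨t, hm⟩).trans (LinearPMap.mkSpanSingleton_apply ℝ ℝ ht (phi W q t))

theorem isClosed_dualPolyhedron (W : Matrix (Fin s) (Fin m) ℝ) (q : Fin m → ℝ) :
    IsClosed (dualPolyhedron W q) := by
  have : dualPolyhedron W q = ⋂ j, {v : E s | (Wᵀ *ᵥ v.ofLp) j ≤ q j} := by
    ext v; simp [dualPolyhedron]
  rw [this]
  refine isClosed_iInter fun j => isClosed_le ?_ continuous_const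
  simp only [Matrix.mulVec, dotProduct]
  fun_prop

/-- Weak duality in the directions ±e_i bounds every coordinate of a dual point. The summand 1 keeps
the bound positive when s = 0. -/
theorem exists_norm_le (h1 : CompleteRecourse W) (q : Fin m → ℝ) :
    ∃ L : ℝ, 0 < L ∧ ∀ v ∈ dualPolyhedron W q, ‖v‖ ≤ L := by
  let e : Fin s → E s := fun i => EuclideanSpace.single i 1
  let C : ℝ := ∑ i, (|phi W q (e i)| + |phi W q (-e i)|)
  have hC : 0 ≤ C := Finset.sum_nonneg fun i _ => by positivity
  refine ⟨∑ _i : Fin s, C + 1, by positivity, fun v hv => ?_⟩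
  have hi : ∀ i, ‖v i‖ ≤ C := fun i => by
    have a1 := inner_le_phi q h1 hv (e i)
    have a2 := inner_le_phi q h1 hv (-e i)
    have a3 : inner ℝ v (e i) = v i := by simp [e, EuclideanSpace.inner_single_right]
    rw [inner_neg_right] at a2
    rw [a3] at a1 a2
    have a4 : |phi W q (e i)| + |phi W q (-e i)| ≤ C :=
      Finset.single_le_sum (f := fun i => |phi W q (e i)| + |phi W q (-e i)|)
        (fun i _ => by positivity) (Finset.mem_univ i)
    rw [Real.norm_eq_abs, abs_le]
    have b1 := le_abs_self (phi W q (e i))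
    have b2 := le_abs_self (phi W q (-e i))
    have b3 := abs_nonneg (phi W q (e i))
    have b4 := abs_nonneg (phi W q (-e i))
    constructor <;> linarith
  have hsum : v = ∑ i, v i • e i := by
    ext j
    simp [e, Finset.sum_apply, Pi.single_apply]
  calc ‖v‖ = ‖∑ i, v i • e i‖ := by rw [← hsum]
    _ ≤ ∑ i, ‖v i • e i‖ := norm_sum_le _ _
    _ ≤ ∑ _i : Fin s, C := Finset.sum_le_sum fun i _ => by
        rw [norm_smul]; simpa [e] using hi i
    _ ≤ _ := by linarith

theorem isCompact_dualPolyhedron (h1 : CompleteRecourse W) (q : Fin m → ℝ) :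
    IsCompact (dualPolyhedron W q) := by
  obtain ⟨L, -, hL⟩ := exists_norm_le h1 q
  exact Metric.isCompact_of_isClosed_isBounded (isClosed_dualPolyhedron W q)
    ((Metric.isBounded_closedBall (x := (0 : E s)) (r := L)).subset fun v hv => by
      simpa using hL v hv)

theorem phi_le_add_norm (h1 : CompleteRecourse W) (h2 : ExpensiveRecourse W q) :
    ∃ L : ℝ, 0 < L ∧ ∀ x y, phi W q x ≤ phi W q y + L * ‖x - y‖ := by
  obtain ⟨L, hL, h⟩ := exists_norm_le h1 q
  refine ⟨L, hL, fun x y => ?_⟩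
  obtain ⟨v, hv, e⟩ := exists_dual_eq_phi h1 h2 x
  have a1 := inner_le_phi q h1 hv y
  have a2 : inner ℝ v x = inner ℝ v y + inner ℝ v (x - y) := by rw [inner_sub_right]; ring
  have a3 := (real_inner_le_norm v (x - y)).trans
    (mul_le_mul_of_nonneg_right (h v hv) (norm_nonneg _))
  linarith

/-! ### Vertices of the dual polyhedron and the cones of linearity. -/

/-- The vertices of the dual polyhedron attain the value of `phi`. -/
theorem exists_vertex_eq_phi (h1 : CompleteRecourse W) (h2 : ExpensiveRecourse W q) (t : E s) :
    ∃ d ∈ vertices W q, inner ℝ d t = phi W q t := by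
  let l : StrongDual ℝ (E s) := innerSL ℝ t
  have hl : ∀ v, l v = inner ℝ v t := fun v => by simp [l, real_inner_comm]
  have hexp : IsExposed ℝ (dualPolyhedron W q) (l.toExposed (dualPolyhedron W q)) :=
    ContinuousLinearMap.toExposed.isExposed
  obtain ⟨v, hv, e⟩ := exists_dual_eq_phi h1 h2 t
  have hne : (l.toExposed (dualPolyhedron W q)).Nonempty :=
    ⟨v, hv, fun w hw => by rw [hl, hl, e]; exact inner_le_phi q h1 hw t⟩
  -- The dual points maximizing the inner product with t form a compact exposed face, and an extreme
  -- point of this face is a vertex of the polyhedron.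
  obtain ⟨d, hd⟩ := (hexp.isCompact (isCompact_dualPolyhedron h1 q)).extremePoints_nonempty hne
  refine ⟨d, hexp.isExtreme.extremePoints_subset_extremePoints hd, ?_⟩
  refine le_antisymm (inner_le_phi q h1 hd.1.1 t) ?_
  have := hd.1.2 v hv
  rwa [hl, hl, e] at this

theorem vertices_subset (W : Matrix (Fin s) (Fin m) ℝ) (q : Fin m → ℝ) :
    vertices W q ⊆ dualPolyhedron W q := extremePoints_subset

/-- K_i is where d_i attains the maximum defining φ; in this form membership can be tested by
inequalities for φ alone. -/
theorem mem_linCone_iff (h1 : CompleteRecourse W) (h2 : ExpensiveRecourse W q) {d : E s}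
    (hd : d ∈ vertices W q) (z : E s) : z ∈ linCone W q d ↔ inner ℝ d z = phi W q z := by
  constructor
  · intro hz
    obtain ⟨e, he, hez⟩ := exists_vertex_eq_phi h1 h2 z
    have := hz e he
    rw [inner_sub_left] at this
    have h3 := inner_le_phi q h1 (vertices_subset W q hd) z
    linarith
  · intro hz e he
    have h3 := inner_le_phi q h1 (vertices_subset W q he) z
    rw [inner_sub_left]
    linarith

/-- A vertex is determined by its set of active constraints: with the same active set, v ± ε(v' - v)
stays feasible for small ε, so extremality of v forces v' = v. -/
theorem finite_vertices (W : Matrix (Fin s) (Fin m) ℝ) (q : Fin m → ℝ) :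
    (vertices W q).Finite := by
  refine Set.Finite.of_finite_image
    (f := fun v : E s => {j | (Wᵀ *ᵥ v.ofLp) j = q j}) (Set.toFinite _) ?_
  intro v hv v' hv' hvv
  have hcont : ∀ j, Continuous fun ε : ℝ => (Wᵀ *ᵥ (v + ε • (v' - v) : E s).ofLp) j := fun j => by
    simp only [Matrix.mulVec, dotProduct]
    fun_prop
  have hev : ∀ᶠ ε : ℝ in nhds 0, v + ε • (v' - v) ∈ dualPolyhedron W q := by
    refine Filter.eventually_all.2 fun j => ?_
    by_cases hj : (Wᵀ *ᵥ v.ofLp) j = q j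
    · have hj' : (Wᵀ *ᵥ v'.ofLp) j = q j := by
        have : j ∈ {j | (Wᵀ *ᵥ v.ofLp) j = q j} := hj
        simp only at hvv
        rwa [hvv] at this
      refine Filter.Eventually.of_forall fun ε => le_of_eq ?_
      have : (Wᵀ *ᵥ (v + ε • (v' - v) : E s).ofLp) j
          = (Wᵀ *ᵥ v.ofLp) j + ε * ((Wᵀ *ᵥ v'.ofLp) j - (Wᵀ *ᵥ v.ofLp) j) := by
        simp [Matrix.mulVec_add, Matrix.mulVec_smul, Matrix.mulVec_sub]
      rw [this, hj, hj']
      ring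
    · have hlt : (Wᵀ *ᵥ (v + (0 : ℝ) • (v' - v) : E s).ofLp) j < q j := by
        rw [zero_smul, add_zero]
        exact lt_of_le_of_ne (hv.1 j) hj
      exact ((hcont j).continuousAt.eventually_lt continuousAt_const hlt).mono fun _ h => h.le
  obtain ⟨ε, hε, h⟩ := Metric.eventually_nhds_iff.1 hev
  have hpos := half_pos hε
  have e1 := @h (ε / 2) (by rw [Real.dist_eq, sub_zero, abs_of_pos hpos]; linarith)
  have e2 := @h (-(ε / 2)) (by rw [Real.dist_eq, sub_zero, abs_neg, abs_of_pos hpos]; linarith)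
  have := hv.2 e1 e2 ⟨1 / 2, 1 / 2, by norm_num, by norm_num, by norm_num, by module⟩
  rw [add_eq_left, smul_eq_zero, sub_eq_zero] at this
  exact (this.resolve_left hpos.ne').symm

/-- The dual polyhedron has positive width. -/
theorem exists_pos_le_phi_add_phi_neg (h1 : CompleteRecourse W) (h2 : ExpensiveRecourse W q) :
    ∃ ω : ℝ, 0 < ω ∧ ∀ u, ‖u‖ = 1 → ω ≤ phi W q u + phi W q (-u) := by
  obtain ⟨v, hv⟩ := h2
  have hev : ∀ᶠ w : E s in nhds v, w ∈ dualPolyhedron W q := by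
    refine Filter.eventually_all.2 fun j => ?_
    have hcont : Continuous fun w : E s => (Wᵀ *ᵥ w.ofLp) j := by
      simp only [Matrix.mulVec, dotProduct]
      fun_prop
    exact (hcont.continuousAt.eventually_lt continuousAt_const (hv j)).mono fun _ h => h.le
  obtain ⟨ε, hε, h⟩ := Metric.eventually_nhds_iff.1 hev
  refine ⟨ε / 2, half_pos hε, fun u hu => ?_⟩
  -- Bound φ(u) from below by the shifted point and φ(-u) by v itself; the terms in v cancel.
  have e1 : v + (ε / 2) • u ∈ dualPolyhedron W q := h (by
    rw [dist_eq_norm, add_sub_cancel_left, norm_smul, hu, Real.norm_eq_abs,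
      abs_of_pos (half_pos hε)]
    linarith)
  have a1 := inner_le_phi q h1 e1 u
  have a2 := inner_le_phi q h1 (v := v) (fun j => (hv j).le) (-u)
  rw [inner_add_left, real_inner_smul_left, real_inner_self_eq_norm_sq, hu] at a1
  rw [inner_neg_right] at a2
  linarith

theorem continuous_phi (h1 : CompleteRecourse W) (h2 : ExpensiveRecourse W q) :
    Continuous (phi W q) := by
  obtain ⟨L, hL, h⟩ := phi_le_add_norm h1 h2
  exact (LipschitzWith.of_le_add_mul L.toNNReal fun x y => by
    rw [Real.coe_toNNReal _ hL.le, dist_eq_norm]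
    exact h x y).continuous

theorem interior_biUnion_eq_empty {X ι : Type*} [TopologicalSpace X] {T : Set ι} (hT : T.Finite)
    {f : ι → Set X} (hc : ∀ d ∈ T, IsClosed (f d)) (hi : ∀ d ∈ T, interior (f d) = ∅) :
    interior (⋃ d ∈ T, f d) = ∅ := by
  induction T, hT using Set.Finite.induction_on with
  | empty => simp
  | @insert a T _ _ ih =>
    rw [Set.biUnion_insert, interior_union_isClosed_of_interior_empty (hc a (by simp))
      (ih (fun d hd => hc d (by simp [hd])) fun d hd => hi d (by simp [hd]))]
    exact hi a (by simp)

theorem isClosed_linCone (W : Matrix (Fin s) (Fin m) ℝ) (q : Fin m → ℝ) (d : E s) :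
    IsClosed (linCone W q d) := by
  have : linCone W q d = ⋂ e ∈ vertices W q, {z | 0 ≤ inner ℝ (d - e) z} := by
    ext z; simp [linCone]
  rw [this]
  exact isClosed_biInter fun e _ => isClosed_le continuous_const (by fun_prop)

/-- The cones `K_i`, `i ∈ I⁺`, cover the set where `phi` is positive. -/
theorem exists_mem_linCone_of_phi_pos (h1 : CompleteRecourse W) (h2 : ExpensiveRecourse W q)
    {u : E s} (hu : 0 < phi W q u) : ∃ d ∈ IPlus W q, u ∈ linCone W q d := by
  by_contra! hcon
  let T : Set (E s) := {d | d ∈ vertices W q ∧ interior (linConePos W q d) = ∅}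
  have hT : T.Finite := (finite_vertices W q).subset fun d hd => hd.1
  have hfin : (IPlus W q).Finite := (finite_vertices W q).subset fun d hd => hd.1
  have hC : IsClosed (⋃ d ∈ IPlus W q, linCone W q d) :=
    hfin.isClosed_biUnion fun d _ => isClosed_linCone W q d
  -- If the claim fails, U is a nonempty open set covered by finitely many closed cones with empty
  -- interior, which is impossible. The vertex 0 cannot intervene since φ > 0 on U.
  let U : Set (E s) := {z | 0 < phi W q z} ∩ (⋃ d ∈ IPlus W q, linCone W q d)ᶜ
  have hU : IsOpen U := (isOpen_lt continuous_const (continuous_phi h1 h2)).inter hC.isOpen_compl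
  have hsub : U ⊆ ⋃ d ∈ T, linConePos W q d := by
    rintro z ⟨hz, hzC⟩
    obtain ⟨d, hd, hdz⟩ := exists_vertex_eq_phi h1 h2 z
    have hzd : z ∈ linCone W q d := (mem_linCone_iff h1 h2 hd z).2 hdz
    have hz0 : 0 < phi W q z := hz
    refine Set.mem_biUnion (x := d) ⟨hd, ?_⟩ ⟨hzd, by show 0 ≤ inner ℝ d z; rw [hdz]; exact hz0.le⟩
    by_contra hne
    refine hzC (Set.mem_biUnion (x := d) ⟨hd, Set.nonempty_iff_ne_empty.2 hne, ?_⟩ hzd)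
    rintro rfl
    rw [inner_zero_left] at hdz
    linarith
  have hemp := interior_biUnion_eq_empty hT (f := linConePos W q)
    (fun d _ => (isClosed_linCone W q d).inter (isClosed_le continuous_const (by fun_prop)))
    (fun d hd => hd.2)
  have huU : u ∈ U := ⟨hu, by simpa using hcon⟩
  have := interior_maximal hsub hU huU
  rw [hemp] at this
  exact this

/-- Along an extreme ray, `phi` is not affine in any transversal direction. -/
theorem SpansExtremeRay.two_mul_phi_lt (h1 : CompleteRecourse W) (h2 : ExpensiveRecourse W q)
    {d t u : E s} (hd : d ∈ vertices W q) (ht : SpansExtremeRay (linCone W q d) t)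
    (hu : ∀ c : ℝ, u ≠ c • t) : 2 * phi W q t < phi W q (t + u) + phi W q (t - u) := by
  by_contra! hcon
  have htr : t ∈ ray t := ⟨1, zero_le_one, (one_smul _ _).symm⟩
  have e0 := (mem_linCone_iff h1 h2 hd t).1 (ht.2.subset htr)
  have hdd := vertices_subset W q hd
  have e1 := inner_le_phi q h1 hdd (t + u)
  have e2 := inner_le_phi q h1 hdd (t - u)
  have e1' := inner_add_right (𝕜 := ℝ) d t u
  have e2' := inner_sub_right (𝕜 := ℝ) d t u
  -- Without strict inequality, d attains φ at both t + u and t - u. Then t is the midpoint of two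
  -- points of K_i, and extremality puts t + u on the ray.
  have m1 : t + u ∈ linCone W q d := (mem_linCone_iff h1 h2 hd _).2 (by linarith)
  have m2 : t - u ∈ linCone W q d := (mem_linCone_iff h1 h2 hd _).2 (by linarith)
  obtain ⟨c, -, hc⟩ := ht.2.left_mem_of_mem_openSegment m1 m2 htr
    ⟨1 / 2, 1 / 2, by norm_num, by norm_num, by norm_num, by module⟩
  refine hu (c - 1) ?_
  rw [sub_smul, one_smul, ← hc]
  abel

/-- A unit vector on an extreme ray along which `phi` grows with slope at least `δ`, and fast
enough to pass the threshold inside the ball of radius `ρ`. -/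
theorem IsDelta.exists_direction (h1 : CompleteRecourse W) (h2 : ExpensiveRecourse W q)
    {ρ η₀ δ : ℝ} (hη₀ : 0 < η₀) (hA5 : ThresholdCondition W q η₀ ρ)
    (hδ : IsDelta W q δ) :
    ∃ t : E s, ‖t‖ = 1 ∧ 0 < δ ∧ δ ≤ phi W q t ∧ η₀ < ρ * phi W q t ∧
      ∀ u : E s, (∀ c : ℝ, u ≠ c • t) →
        2 * phi W q t < phi W q (t + u) + phi W q (t - u) := by
  have key : ∀ d ∈ IPlus W q, ∃ y : E s, IsYHat W q d η₀ y ∧ 0 < ‖y‖ ∧ ∃ t : E s, ‖t‖ = 1 ∧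
      phi W q t = η₀ / ‖y‖ ∧ η₀ < ρ * phi W q t ∧
      ∀ u : E s, (∀ c : ℝ, u ≠ c • t) →
        2 * phi W q t < phi W q (t + u) + phi W q (t - u) := by
    intro d hd
    obtain ⟨y, hy, hyρ⟩ := hA5 d hd
    obtain ⟨⟨hyη, t, ht, c, hc, rfl⟩, -⟩ := id hy
    have hc : 0 < c := by
      rcases hc.eq_or_lt with rfl | hc
      · simp at hyη; linarith
      · exact hc
    have htn : 0 < ‖t‖ := norm_pos_iff.2 ht.1
    have hyn : 0 < ‖c • t‖ := by rw [norm_smul, Real.norm_of_nonneg hc.le]; positivity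
    have hdt : inner ℝ d t = phi W q t :=
      (mem_linCone_iff h1 h2 hd.1 t).1 (ht.2.subset ⟨1, zero_le_one, (one_smul _ _).symm⟩)
    have hphi : phi W q (‖t‖⁻¹ • t) = η₀ / ‖c • t‖ := by
      rw [phi_smul h1 h2 (by positivity), norm_smul, Real.norm_of_nonneg hc.le, ← hyη,
        real_inner_smul_right, hdt]
      field_simp
    refine ⟨c • t, hy, hyn, ‖t‖⁻¹ • t, ?_, hphi, ?_, fun u hu => ?_⟩
    · rw [norm_smul, norm_inv, norm_norm, inv_mul_cancel₀ htn.ne']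
    · rw [hphi, mul_div_assoc', lt_div_iff₀ hyn]
      nlinarith
    · have := ht.two_mul_phi_lt h1 h2 hd.1 (u := ‖t‖ • u) fun c hc => hu c (by
        rw [smul_comm, ← hc, smul_smul, inv_mul_cancel₀ htn.ne', one_smul])
      have e1 : ‖t‖⁻¹ • t + u = ‖t‖⁻¹ • (t + ‖t‖ • u) := by
        rw [smul_add, smul_smul, inv_mul_cancel₀ htn.ne', one_smul]
      have e2 : ‖t‖⁻¹ • t - u = ‖t‖⁻¹ • (t - ‖t‖ • u) := by
        rw [smul_sub, smul_smul, inv_mul_cancel₀ htn.ne', one_smul]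
      have hi : (0 : ℝ) ≤ ‖t‖⁻¹ := by positivity
      rw [e1, e2, phi_smul h1 h2 hi, phi_smul h1 h2 hi, phi_smul h1 h2 hi]
      have := mul_lt_mul_of_pos_left this (inv_pos.2 htn)
      linarith
  -- Only attainment of the maximum is needed: δ is the constant of a single index, and the ray of
  -- that index serves as t.
  obtain ⟨a, c, ha, hc, ⟨d, hd, rfl⟩ | ⟨d, hd, rfl⟩, -⟩ := hδ
  · obtain ⟨y, hy, hyn, t, h3, h4, h5, h6⟩ := key d hd.1
    obtain ⟨hpos, hle⟩ := ha d hd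
    refine ⟨t, h3, hpos, ?_, h5, h6⟩
    obtain ⟨⟨hyη, t', ht', hyt'⟩, -⟩ := hy
    rw [h4, le_div_iff₀ hyn, ← hyη]
    exact hle y (ht'.2.subset hyt')
  · obtain ⟨y, hy, hyn, t, h3, h4, h5, h6⟩ := key d hd.1
    obtain ⟨hpos, g, ⟨η, y', t', hη, hy', ht'1, ht', ⟨c', hc', rfl⟩, rfl⟩, hlt⟩ := hc d hd
    refine ⟨t, h3, hpos, ?_, h5, h6⟩
    have hg : 0 < inner ℝ d t' := hpos.trans hlt
    -- γ may come from another level η, but depends only on the direction t'. Rescaling t' to level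
    -- η₀ and comparing norms with ŷ(η₀) gives γ ≤ η₀ / ‖ŷ(η₀)‖ = φ(t).
    have hmin := hy.2 ((η₀ / inner ℝ d t') • t')
      ⟨by rw [real_inner_smul_right]; field_simp, t', ht', _, by positivity, rfl⟩
    rw [norm_smul, ht'1, mul_one, Real.norm_of_nonneg (by positivity), le_div_iff₀ hg] at hmin
    rw [h4, le_div_iff₀ hyn]
    nlinarith

end Recourse

/-! ### Second differences of truncated convex functions on a line. -/

/-- The second difference, with step `ε` in direction `(-1, τ)`, of
`(h, η) ↦ max {0, ψ(h) - η}`. -/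
def excessDiff (ψ : ℝ → ℝ) (τ η ε h : ℝ) : ℝ :=
  max 0 (ψ (h - ε) - η - ε * τ) + max 0 (ψ (h + ε) - η + ε * τ) - 2 * max 0 (ψ h - η)

theorem continuous_excessDiff {ψ : ℝ → ℝ} (hψ : Continuous ψ) (τ η ε : ℝ) :
    Continuous (excessDiff ψ τ η ε) := by
  unfold excessDiff
  fun_prop

theorem two_mul_le_of_convexOn {ψ : ℝ → ℝ} (hψ : ConvexOn ℝ Set.univ ψ) (h ε : ℝ) :
    2 * ψ h ≤ ψ (h - ε) + ψ (h + ε) := by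
  have := hψ.2 (Set.mem_univ (h - ε)) (Set.mem_univ (h + ε))
    (show (0 : ℝ) ≤ 1 / 2 by norm_num) (show (0 : ℝ) ≤ 1 / 2 by norm_num) (by norm_num)
  simp only [smul_eq_mul] at this
  rw [show 1 / 2 * (h - ε) + 1 / 2 * (h + ε) = h by ring] at this
  linarith

theorem excessDiff_nonneg {ψ : ℝ → ℝ} (hψ : ConvexOn ℝ Set.univ ψ) (τ η ε h : ℝ) :
    0 ≤ excessDiff ψ τ η ε h := by
  have e := two_mul_le_of_convexOn hψ h ε
  unfold excessDiff
  rcases max_cases 0 (ψ h - η) with ⟨e1, -⟩ | ⟨e1, -⟩ <;> rw [e1]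
  · have := le_max_left 0 (ψ (h - ε) - η - ε * τ)
    have := le_max_left 0 (ψ (h + ε) - η + ε * τ)
    linarith
  · have := le_max_right 0 (ψ (h - ε) - η - ε * τ)
    have := le_max_right 0 (ψ (h + ε) - η + ε * τ)
    linarith

/-- Pass through the intermediate chord from x to y', moving one endpoint at a time. -/
theorem chord_slope_mono {ψ : ℝ → ℝ} (hψ : ConvexOn ℝ Set.univ ψ) {x y x' y' : ℝ} (hxy : x < y)
    (hxy' : x' < y') (hx : x ≤ x') (hy : y ≤ y') :
    (ψ y - ψ x) / (y - x) ≤ (ψ y' - ψ x') / (y' - x') := by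
  have h1 := hψ.secant_mono (a := x) (Set.mem_univ _) (Set.mem_univ y) (Set.mem_univ y')
    hxy.ne' (hxy.trans_le hy).ne' hy
  have h2 := hψ.secant_mono (a := y') (Set.mem_univ _) (Set.mem_univ x) (Set.mem_univ x')
    (hxy.trans_le hy).ne hxy'.ne hx
  have e1 : (ψ x - ψ y') / (x - y') = (ψ y' - ψ x) / (y' - x) := by
    rw [← neg_sub y' x, ← neg_sub (ψ y'), neg_div_neg_eq]
  have e2 : (ψ x' - ψ y') / (x' - y') = (ψ y' - ψ x') / (y' - x') := by
    rw [← neg_sub y' x', ← neg_sub (ψ y'), neg_div_neg_eq]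
  rw [e1, e2] at h2
  exact h1.trans h2

theorem increment_mono {ψ : ℝ → ℝ} (hψ : ConvexOn ℝ Set.univ ψ) {x y ε : ℝ} (hε : 0 < ε)
    (hxy : x ≤ y) : ψ (x + ε) - ψ x ≤ ψ (y + ε) - ψ y := by
  have := chord_slope_mono hψ (lt_add_of_pos_right x hε) (lt_add_of_pos_right y hε) hxy
    (by linarith)
  rw [add_sub_cancel_left, add_sub_cancel_left] at this
  exact (div_le_div_iff_of_pos_right hε).1 this

/-- Telescoping: only windows of length ε around the two ends survive. Each compares integrals of ψ
on adjacent intervals, that is, integrates an increment of ψ. -/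
theorem integral_second_diff {ψ : ℝ → ℝ} (hψ : Continuous ψ) (a b ε : ℝ) :
    ∫ h in a..b, (ψ (h - ε) + ψ (h + ε) - 2 * ψ h) =
      (∫ x in 0..ε, (ψ (b - ε + x + ε) - ψ (b - ε + x))) -
        ∫ x in 0..ε, (ψ (a - ε + x + ε) - ψ (a - ε + x)) := by
  have hi : ∀ (g : ℝ → ℝ), Continuous g → ∀ x y, IntervalIntegrable g volume x y :=
    fun g hg x y => hg.intervalIntegrable x y
  have hP : ∀ x y, ∫ t in x..y, ψ t = (∫ t in 0..y, ψ t) - ∫ t in 0..x, ψ t := fun x y =>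
    (intervalIntegral.integral_interval_sub_left (hi ψ hψ _ _) (hi ψ hψ _ _)).symm
  have h1 : ∀ c : ℝ, ∫ x in 0..ε, (ψ (c - ε + x + ε) - ψ (c - ε + x)) =
      (∫ t in c..c + ε, ψ t) - ∫ t in c - ε..c, ψ t := fun c => by
    rw [intervalIntegral.integral_sub (hi _ (by fun_prop) _ _) (hi _ (by fun_prop) _ _)]
    congr 1
    · have := intervalIntegral.integral_comp_add_left (a := 0) (b := ε) ψ c
      rw [add_zero] at this
      rw [← this]
      congr 1; ext x; ring_nf
    · have := intervalIntegral.integral_comp_add_left (a := 0) (b := ε) ψ (c - ε)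
      rw [add_zero, sub_add_cancel] at this
      exact this
  rw [h1, h1, intervalIntegral.integral_sub (hi _ (by fun_prop) _ _) (hi _ (by fun_prop) _ _),
    intervalIntegral.integral_add (hi _ (by fun_prop) _ _) (hi _ (by fun_prop) _ _),
    intervalIntegral.integral_const_mul, intervalIntegral.integral_comp_sub_right,
    intervalIntegral.integral_comp_add_right]
  rw [hP (a - ε) (b - ε), hP (a + ε) (b + ε), hP a b, hP b (b + ε), hP (b - ε) b, hP a (a + ε),
    hP (a - ε) a]
  ring

/-- Above the threshold, the integral of the second difference is at least the total increase
of the slope. -/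
theorem sq_mul_le_integral_excessDiff {ψ : ℝ → ℝ} (hψ : ConvexOn ℝ Set.univ ψ)
    (hc : Continuous ψ) {a b ε η τ S S' : ℝ} (hab : a ≤ b) (hε : 0 < ε)
    (hη : ∀ h ∈ Set.Icc a b, η ≤ ψ h)
    (ha : ψ (a + ε) - ψ a ≤ S' * ε) (hb : S * ε ≤ ψ b - ψ (b - ε)) :
    (S - S') * ε ^ 2 ≤ ∫ h in a..b, excessDiff ψ τ η ε h := by
  have h1 : ∫ h in a..b, (ψ (h - ε) + ψ (h + ε) - 2 * ψ h) ≤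
      ∫ h in a..b, excessDiff ψ τ η ε h := by
    refine intervalIntegral.integral_mono_on hab
      (Continuous.intervalIntegrable (by fun_prop) _ _)
      ((continuous_excessDiff hc τ η ε).intervalIntegrable _ _) fun h hh => ?_
    unfold excessDiff
    -- Above the threshold the middle term is not truncated, and the shifts ±ετ cancel, so τ drops
    -- out.
    rw [max_eq_right (sub_nonneg.2 (hη h hh))]
    have := le_max_right 0 (ψ (h - ε) - η - ε * τ)
    have := le_max_right 0 (ψ (h + ε) - η + ε * τ)
    linarith
  rw [integral_second_diff hc] at h1
  have h2 : ∫ _x in 0..ε, S * ε ≤ ∫ x in 0..ε, (ψ (b - ε + x + ε) - ψ (b - ε + x)) := by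
    refine intervalIntegral.integral_mono_on hε.le (by simp)
      (Continuous.intervalIntegrable (by fun_prop) _ _) fun x hx => ?_
    have := increment_mono hψ hε (x := b - ε) (y := b - ε + x) (by linarith [hx.1])
    rw [sub_add_cancel] at this
    linarith
  have h3 : ∫ x in 0..ε, (ψ (a - ε + x + ε) - ψ (a - ε + x)) ≤ ∫ _x in 0..ε, S' * ε := by
    refine intervalIntegral.integral_mono_on hε.le
      (Continuous.intervalIntegrable (by fun_prop) _ _) (by simp) fun x hx => ?_
    have := increment_mono hψ hε (x := a - ε + x) (y := a) (by linarith [hx.2])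
    linarith
  rw [intervalIntegral.integral_const, sub_zero, smul_eq_mul] at h2 h3
  nlinarith

/-- The contribution of a point where `ψ` crosses the threshold upwards. -/
theorem sq_mul_le_integral_excessDiff_of_crossing {ψ : ℝ → ℝ} (hψ : ConvexOn ℝ Set.univ ψ)
    (hc : Continuous ψ) {L : ℝ} (hL : 0 < L) (hLip : ∀ x y, |ψ x - ψ y| ≤ L * |x - y|)
    {c b ε η τ p β : ℝ} (hε : 0 < ε) (hβ : -β ≤ τ) (hp : β < p) (hcη : ψ c = η)
    (hcp : p * ε ≤ ψ (c + ε) - ψ c) (hb : c + ε * (p - β) / (2 * L) ≤ b) :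
    (p - β) ^ 2 / (4 * L) * ε ^ 2 ≤ ∫ h in c..b, excessDiff ψ τ η ε h := by
  set l := ε * (p - β) / (2 * L) with hl
  have hpb : 0 < p - β := sub_pos.2 hp
  have hl0 : 0 < l := by positivity
  have hLl : L * l = ε * (p - β) / 2 := by rw [hl]; field_simp
  have hi : ∀ x y, IntervalIntegrable (excessDiff ψ τ η ε) volume x y := fun x y =>
    (continuous_excessDiff hc τ η ε).intervalIntegrable _ _
  -- On a window of length l after the crossing, ψ - η is at most ε(p - β)/2, while the forward
  -- increment plus ετ is at least ε(p - β). Bounding the backward term by 0 leaves ε(p - β)/2 on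
  -- the whole window.
  have h1 : ∫ _h in c..c + l, ε * (p - β) / 2 ≤ ∫ h in c..c + l, excessDiff ψ τ η ε h := by
    refine intervalIntegral.integral_mono_on (by linarith) (by simp) (hi _ _) fun h hh => ?_
    have e1 := increment_mono hψ hε hh.1
    have e2 := hLip h c
    rw [abs_of_nonneg (sub_nonneg.2 hh.1)] at e2
    have e3 : L * (h - c) ≤ L * l := mul_le_mul_of_nonneg_left (by linarith [hh.2]) hL.le
    obtain ⟨e4, e5⟩ := abs_le.1 e2
    have e6 : ε * -β ≤ ε * τ := mul_le_mul_of_nonneg_left hβ hε.le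
    unfold excessDiff
    have := le_max_left 0 (ψ (h - ε) - η - ε * τ)
    have := le_max_right 0 (ψ (h + ε) - η + ε * τ)
    rcases max_cases 0 (ψ h - η) with ⟨e7, -⟩ | ⟨e7, -⟩ <;> rw [e7] <;> nlinarith
  have h2 : 0 ≤ ∫ h in c + l..b, excessDiff ψ τ η ε h :=
    intervalIntegral.integral_nonneg hb fun h _ => excessDiff_nonneg hψ _ _ _ _
  rw [← intervalIntegral.integral_add_adjacent_intervals (hi c (c + l)) (hi _ _)]
  rw [intervalIntegral.integral_const, add_sub_cancel_left, smul_eq_mul] at h1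
  have h3 : l * (ε * (p - β) / 2) = (p - β) ^ 2 / (4 * L) * ε ^ 2 := by rw [hl]; field_simp; ring
  linarith

/-- A convex function which rises well above the threshold. -/
theorem sq_mul_le_integral_excessDiff_of_rise {ψ : ℝ → ℝ} (hψ : ConvexOn ℝ Set.univ ψ)
    (hc : Continuous ψ) {L : ℝ} (hL : 0 < L) (hLip : ∀ x y, |ψ x - ψ y| ≤ L * |x - y|)
    {a b ε η τ p β S S' k M : ℝ} (hab : a ≤ b) (hε : 0 < ε) (hβ : -β ≤ τ) (hp : β < p)
    (ha : ψ (a + ε) - ψ a ≤ S' * ε) (hb : S * ε ≤ ψ b - ψ (b - ε))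
    (hM : 0 < M) (hηb : η + M ≤ ψ b) (hεM : ε * (p - β) ≤ 2 * M)
    (hk1 : k ≤ S - S') (hk2 : k ≤ S - p) (hk3 : k ≤ (p - β) ^ 2 / (4 * L)) :
    k * ε ^ 2 ≤ ∫ h in a..b, excessDiff ψ τ η ε h := by
  have hi : ∀ x y, IntervalIntegrable (excessDiff ψ τ η ε) volume x y := fun x y =>
    (continuous_excessDiff hc τ η ε).intervalIntegrable _ _
  have hsq : 0 ≤ ε ^ 2 := sq_nonneg ε
  by_cases hall : ∀ h ∈ Set.Icc a b, η ≤ ψ h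
  · exact (mul_le_mul_of_nonneg_right hk1 hsq).trans
      (sq_mul_le_integral_excessDiff hψ hc hab hε hall ha hb)
  push Not at hall
  obtain ⟨h0, ⟨ha0, hb0⟩, hlt⟩ := hall
  obtain ⟨c, ⟨hc0, hcb⟩, hcη⟩ := intermediate_value_Icc hb0 hc.continuousOn
    (show η ∈ Set.Icc (ψ h0) (ψ b) from ⟨hlt.le, by linarith⟩)
  have h0c : h0 < c := lt_of_le_of_ne hc0 (by rintro rfl; linarith)
  -- By convexity ψ cannot return below η after rising to it from h0 < c.
  have habove : ∀ h ∈ Set.Icc c b, η ≤ ψ h := by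
    intro h hh
    rcases hh.1.eq_or_lt with rfl | hch
    · exact hcη.ge
    have := chord_slope_mono hψ h0c hch h0c.le hch.le
    rw [hcη] at this
    have h1 : 0 ≤ (ψ h - η) / (h - c) :=
      le_trans (div_nonneg (by linarith) (by linarith)) this
    have h2 : 0 < h - c := sub_pos.2 hch
    rw [le_div_iff₀ h2, zero_mul] at h1
    linarith
  have h1 : 0 ≤ ∫ h in a..c, excessDiff ψ τ η ε h :=
    intervalIntegral.integral_nonneg (ha0.trans hc0) fun h _ => excessDiff_nonneg hψ _ _ _ _
  rw [← intervalIntegral.integral_add_adjacent_intervals (hi a c) (hi c b)]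
  refine le_add_of_nonneg_of_le h1 ?_
  -- Either the crossing is steeper than p, and the kink of the truncation suffices, or the slope
  -- still has to grow from p to S on [c, b].
  rcases le_total (p * ε) (ψ (c + ε) - ψ c) with hcp | hcp
  · refine (mul_le_mul_of_nonneg_right hk3 hsq).trans
      (sq_mul_le_integral_excessDiff_of_crossing hψ hc hL hLip hε hβ hp hcη hcp ?_)
    have e1 := (le_abs_self _).trans (hLip b c)
    rw [abs_of_nonneg (sub_nonneg.2 hcb), hcη] at e1
    rw [← le_sub_iff_add_le', div_le_iff₀ (by positivity)]
    nlinarith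
  · exact (mul_le_mul_of_nonneg_right hk2 hsq).trans
      (sq_mul_le_integral_excessDiff hψ hc hcb hε habove hcp hb)

/-! ### Averaging over parallel lines -/

/-- Fubini: integrate the line bounds over w in the small ball and swap. For each h the translated
ball lies in the large one, and g ≥ 0. -/
theorem measure_mul_le_of_le_lineIntegral {g : E s → ℝ} (hg : Continuous g) (hg0 : ∀ z, 0 ≤ g z)
    {z₀ u : E s} {σ ρ a b C : ℝ} (hab : a ≤ b)
    (hsub : ∀ w ∈ Metric.ball z₀ σ, ∀ h ∈ Set.Icc a b, w + h • u ∈ Metric.ball (0 : E s) ρ)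
    (hC : ∀ w ∈ Metric.ball z₀ σ, C ≤ ∫ h in a..b, g (w + h • u)) :
    volume.real (Metric.ball z₀ σ) * C ≤ (b - a) * ∫ z in Metric.ball (0 : E s) ρ, g z := by
  set B := Metric.ball z₀ σ
  have hBfin : volume B ≠ ⊤ := measure_ball_lt_top.ne
  have hgi : IntegrableOn g (Metric.ball (0 : E s) ρ) :=
    (hg.continuousOn.integrableOn_compact (isCompact_closedBall (0 : E s) ρ)).mono_set
      Metric.ball_subset_closedBall
  have hG : Continuous (Function.uncurry fun (h : ℝ) (w : E s) => g (w + h • u)) := by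
    unfold Function.uncurry
    fun_prop
  have hprod : Integrable (Function.uncurry fun (h : ℝ) (w : E s) => g (w + h • u))
      ((volume.restrict (Set.uIoc a b)).prod (volume.restrict B)) := by
    rw [Measure.prod_restrict]
    refine (hG.continuousOn.integrableOn_compact
      ((isCompact_uIcc (a := a) (b := b)).prod (isCompact_closedBall z₀ σ))).mono_set ?_
    exact Set.prod_mono Set.uIoc_subset_uIcc Metric.ball_subset_closedBall
  have hswap := intervalIntegral_integral_swap hprod
  have h1 : volume.real B * C ≤ ∫ w in B, ∫ h in a..b, g (w + h • u) := by
    have : ∫ _w in B, C ≤ ∫ w in B, ∫ h in a..b, g (w + h • u) := by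
      refine setIntegral_mono_on (integrableOn_const hBfin) ?_ measurableSet_ball hC
      have := hprod.integral_prod_right
      simpa [IntegrableOn, Function.uncurry, intervalIntegral.integral_of_le hab,
        Set.uIoc_of_le hab] using this
    simpa [Measure.real] using this
  have h2 : ∫ h in a..b, (∫ w in B, g (w + h • u)) ≤
      ∫ _h in a..b, ∫ z in Metric.ball (0 : E s) ρ, g z := by
    have hint : IntervalIntegrable (fun h => ∫ w in B, g (w + h • u)) volume a b := by
      rw [intervalIntegrable_iff]
      exact hprod.integral_prod_left
    refine intervalIntegral.integral_mono_on hab hint (by simp) fun h hh => ?_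
    have e1 : ∫ w in B, g (w + h • u) = ∫ z in (fun z => z - h • u) ⁻¹' B, g z := by
      have hmp := (measurePreserving_sub_right (volume : Measure (E s)) (h • u))
      have := hmp.setIntegral_preimage_emb
        (MeasurableEquiv.subRight (h • u)).measurableEmbedding (fun w => g (w + h • u)) B
      simpa using this.symm
    rw [e1]
    refine setIntegral_mono_set hgi (Filter.Eventually.of_forall hg0)
      (Filter.Eventually.of_forall fun z hz => ?_)
    show z ∈ Metric.ball (0 : E s) ρ
    have := hsub _ hz h hh
    rwa [sub_add_cancel] at this
  rw [intervalIntegral.integral_const, smul_eq_mul] at h2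
  rw [hswap] at h2
  exact h1.trans h2

/-! ### Lower bounds for sublinear functions -/

/-- `f` is sublinear and Lipschitz with constant `L > 0`. -/
structure IsLipschitzSublinear (f : E s → ℝ) (L : ℝ) : Prop where
  pos : 0 < L
  add_le : ∀ x y, f (x + y) ≤ f x + f y
  smul : ∀ c : ℝ, 0 ≤ c → ∀ x, f (c • x) = c * f x
  le_add : ∀ x y, f x ≤ f y + L * ‖x - y‖

namespace IsLipschitzSublinear

variable {f : E s → ℝ} {L : ℝ}

theorem abs_sub_le (hf : IsLipschitzSublinear f L) (x y : E s) : |f x - f y| ≤ L * ‖x - y‖ := by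
  have h1 := hf.le_add x y
  have h2 := hf.le_add y x
  rw [norm_sub_rev] at h2
  rw [abs_le]
  constructor <;> linarith

theorem continuous (hf : IsLipschitzSublinear f L) : Continuous f :=
  (LipschitzWith.of_le_add_mul L.toNNReal fun x y => by
    rw [Real.coe_toNNReal _ hf.pos.le, dist_eq_norm]
    exact hf.le_add x y).continuous

theorem convexOn (hf : IsLipschitzSublinear f L) : ConvexOn ℝ Set.univ f :=
  ⟨convex_univ, fun x _ y _ a b ha hb _ => by
    have := hf.add_le (a • x) (b • y)
    rwa [hf.smul a ha, hf.smul b hb] at this⟩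

theorem convexOn_line (hf : IsLipschitzSublinear f L) (w u : E s) :
    ConvexOn ℝ Set.univ fun h : ℝ => f (w + h • u) :=
  ⟨convex_univ, fun x _ y _ a b ha hb hab => by
    have := hf.convexOn.2 (Set.mem_univ (w + x • u)) (Set.mem_univ (w + y • u)) ha hb hab
    have e : w + (a • x + b • y) • u = a • (w + x • u) + b • (w + y • u) := by
      obtain rfl : b = 1 - a := by linarith
      simp only [smul_eq_mul]
      module
    simp only
    rw [e]
    exact this⟩

theorem continuous_line (hf : IsLipschitzSublinear f L) (w u : E s) :
    Continuous fun h : ℝ => f (w + h • u) := by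
  have := hf.continuous
  fun_prop

theorem abs_line_sub_le (hf : IsLipschitzSublinear f L) (w : E s) {u : E s} (hu : ‖u‖ = 1)
    (x y : ℝ) : |f (w + x • u) - f (w + y • u)| ≤ L * |x - y| := by
  have := hf.abs_sub_le (w + x • u) (w + y • u)
  rwa [add_sub_add_left_eq_sub, ← sub_smul, norm_smul, hu, mul_one, Real.norm_eq_abs] at this

theorem abs_add_sub_le (hf : IsLipschitzSublinear f L) {z₀ w : E s} {σ : ℝ}
    (hw : w ∈ Metric.ball z₀ σ) (x : E s) : |f (w + x) - f (z₀ + x)| ≤ L * σ := by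
  have := hf.abs_sub_le (w + x) (z₀ + x)
  rw [add_sub_add_right_eq_sub] at this
  exact this.trans (mul_le_mul_of_nonneg_left (mem_ball_iff_norm.1 hw).le hf.pos.le)

end IsLipschitzSublinear

/-- The second difference, with step `ε` in direction `(-u, τ)`, of
`(z, η) ↦ max {0, f(z) - η}`. -/
def excessDiffAlong (f : E s → ℝ) (u : E s) (τ η ε : ℝ) (z : E s) : ℝ :=
  excessDiff (fun h => f (z + h • u)) τ η ε 0

theorem excessDiffAlong_line (f : E s → ℝ) (u w : E s) (τ η ε h : ℝ) :
    excessDiffAlong f u τ η ε (w + h • u) = excessDiff (fun h => f (w + h • u)) τ η ε h := by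
  unfold excessDiffAlong excessDiff
  simp only [add_assoc, ← add_smul]
  simp [sub_eq_add_neg]

theorem excessDiffAlong_neg (f : E s → ℝ) (u z : E s) (τ η ε : ℝ) :
    excessDiffAlong f (-u) (-τ) η ε z = excessDiffAlong f u τ η ε z := by
  unfold excessDiffAlong excessDiff
  simp
  ring_nf

namespace IsLipschitzSublinear

variable {f : E s → ℝ} {L : ℝ}

theorem continuous_excessDiffAlong (hf : IsLipschitzSublinear f L) (u : E s) (τ η ε : ℝ) :
    Continuous (excessDiffAlong f u τ η ε) := by
  have := hf.continuous
  unfold excessDiffAlong excessDiff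
  fun_prop

theorem excessDiffAlong_nonneg (hf : IsLipschitzSublinear f L) (u : E s) (τ η ε : ℝ) (z : E s) :
    0 ≤ excessDiffAlong f u τ η ε z :=
  excessDiff_nonneg (hf.convexOn_line z u) _ _ _ _

/-- The constant is fixed before u, τ, η and ε, which is what makes the final modulus uniform. -/
theorem exists_lower_bound_of_line (hf : IsLipschitzSublinear f L) {z₀ : E s}
    {σ ρ a b k : ℝ} (hab : a < b) (hσ : 0 < σ) (hk : 0 < k) :
    ∃ k' : ℝ, 0 < k' ∧ ∀ (u : E s) (τ η ε : ℝ),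
      (∀ w ∈ Metric.ball z₀ σ, ∀ h ∈ Set.Icc a b, w + h • u ∈ Metric.ball (0 : E s) ρ) →
      (∀ w ∈ Metric.ball z₀ σ,
        k * ε ^ 2 ≤ ∫ h in a..b, excessDiff (fun h => f (w + h • u)) τ η ε h) →
      k' * ε ^ 2 ≤ ∫ z in Metric.ball (0 : E s) ρ, excessDiffAlong f u τ η ε z := by
  have hv : 0 < volume.real (Metric.ball z₀ σ) := by
    rw [Measure.real, ENNReal.toReal_pos_iff]
    exact ⟨Metric.measure_ball_pos _ _ hσ, measure_ball_lt_top⟩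
  have hba : 0 < b - a := sub_pos.2 hab
  refine ⟨volume.real (Metric.ball z₀ σ) * k / (b - a), by positivity, fun u τ η ε h1 h2 => ?_⟩
  have := measure_mul_le_of_le_lineIntegral (hf.continuous_excessDiffAlong u τ η ε)
    (hf.excessDiffAlong_nonneg u τ η ε) hab.le h1 (C := k * ε ^ 2) fun w hw => by
      simpa only [excessDiffAlong_line] using h2 w hw
  rw [div_mul_eq_mul_div, div_le_iff₀ hba]
  linarith

/-- Lower bound in directions in which `f` grows fast. -/
theorem exists_lower_bound_of_steep (hf : IsLipschitzSublinear f L) {η₀ ρ β μ ω : ℝ}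
    (hη₀ : 0 < η₀) (hβ : 0 ≤ β) (hβμ : β < μ) (hμ : η₀ < ρ * μ) (hω : 0 < ω)
    (hw : ∀ u, ‖u‖ = 1 → ω ≤ f u + f (-u)) :
    ∃ k : ℝ, 0 < k ∧ ∃ ε₀ : ℝ, 0 < ε₀ ∧ ∀ (u : E s) (τ η ε : ℝ), ‖u‖ = 1 → μ ≤ f u → -β ≤ τ →
      η ≤ η₀ → 0 < ε → ε ≤ ε₀ →
      k * ε ^ 2 ≤ ∫ z in Metric.ball (0 : E s) ρ, excessDiffAlong f u τ η ε z := by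
  have hL := hf.pos
  have hμ0 : 0 < μ := hβ.trans_lt hβμ
  have hf0 : f 0 = 0 := by simpa using hf.smul 0 le_rfl 0
  -- Lines run over [-b, b] from points near 0: b stays inside the ball, yet bμ exceeds η₀.
  obtain ⟨b, hb1, hb2⟩ : ∃ b, η₀ / μ < b ∧ b < ρ :=
    exists_between ((div_lt_iff₀ hμ0).2 hμ)
  have hb0 : 0 < b := (by positivity : 0 < η₀ / μ).trans hb1
  rw [div_lt_iff₀ hμ0] at hb1
  -- With μ = β + 4g, the perturbed end slope is at least β + 2g and the crossing slope is p = β +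
  -- g, leaving a gap g on each side. M is the margin above the threshold left at b after an error
  -- of at most Lσ.
  set g := (μ - β) / 4 with hg
  have hg0 : 0 < g := by rw [hg]; linarith
  set M := (b * μ - η₀) / 2 with hM
  have hM0 : 0 < M := by rw [hM]; linarith
  obtain ⟨σ, hσ0, hσ⟩ : ∃ σ, 0 < σ ∧ σ ≤ ρ - b ∧ σ ≤ M / L ∧ σ ≤ ω * b / (16 * L) ∧
      σ ≤ 2 * g * b / (4 * L) := by
    have h1 : 0 < ρ - b := sub_pos.2 hb2
    refine ⟨min (min (ρ - b) (M / L)) (min (ω * b / (16 * L)) (2 * g * b / (4 * L))),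
      by positivity, ?_, ?_, ?_, ?_⟩
    · exact (min_le_left _ _).trans (min_le_left _ _)
    · exact (min_le_left _ _).trans (min_le_right _ _)
    · exact (min_le_right _ _).trans (min_le_left _ _)
    · exact (min_le_right _ _).trans (min_le_right _ _)
  obtain ⟨hσ1, hσ2, hσ3, hσ4⟩ := hσ
  rw [le_div_iff₀ (by positivity)] at hσ2 hσ3 hσ4
  have hσ3' : 8 * (L * σ) / b ≤ ω / 2 := by rw [div_le_iff₀ hb0]; linarith
  have hσ4' : 4 * (L * σ) / b ≤ 2 * g := by rw [div_le_iff₀ hb0]; linarith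
  set k := min (ω / 2) (min g (g ^ 2 / (4 * L))) with hk
  have hk0 : 0 < k := by positivity
  obtain ⟨k', hk', H⟩ := hf.exists_lower_bound_of_line (z₀ := 0) (ρ := ρ)
    (neg_lt_self hb0) hσ0 hk0
  refine ⟨k', hk', min (b / 2) (2 * M / g), by positivity, ?_⟩
  intro u τ η ε hu hfu hτ hη hε hε₀
  have hε1 : ε ≤ b / 2 := hε₀.trans (min_le_left _ _)
  have hε2 : ε * g ≤ 2 * M := (le_div_iff₀ hg0).1 (hε₀.trans (min_le_right _ _))
  refine H u τ η ε (fun w hw h hh => ?_) fun w hw' => ?_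
  · rw [mem_ball_zero_iff] at hw ⊢
    calc ‖w + h • u‖ ≤ ‖w‖ + ‖h • u‖ := norm_add_le _ _
      _ ≤ ‖w‖ + b := by
        rw [norm_smul, hu, mul_one, Real.norm_eq_abs]
        gcongr
        exact abs_le.2 hh
      _ < ρ := by linarith
  have hψ := hf.convexOn_line w u
  have near : ∀ c : ℝ, 0 ≤ c → f (w + c • u) ≥ c * f u - L * σ ∧
      f (w + (-c) • u) ≥ c * f (-u) - L * σ := fun c hc => by
    have a1 := (abs_le.1 (hf.abs_add_sub_le hw' (c • u))).1
    have a2 := (abs_le.1 (hf.abs_add_sub_le hw' ((-c) • u))).1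
    rw [zero_add] at a1 a2
    rw [hf.smul c hc] at a1
    rw [show (-c) • u = c • (-u) by module] at a2 ⊢
    rw [hf.smul c hc] at a2
    constructor <;> linarith
  have near0 : f (w + (0 : ℝ) • u) ≤ L * σ := by
    have := (abs_le.1 (hf.abs_add_sub_le hw' ((0 : ℝ) • u))).2
    rw [zero_smul, add_zero, add_zero, hf0] at this
    rw [zero_smul, add_zero]
    linarith
  have hb2 : 0 < b / 2 := half_pos hb0
  -- Slopes at the ends of [-b, b] are compared with chords over the half intervals. These
  -- approximate f(u) and -f(-u) up to 4Lσ/b, so the total increase is at least ω/2.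
  have S1 := chord_slope_mono hψ (x := 0) (y := b / 2) (x' := b - ε) (y' := b) hb2
    (by linarith) (by linarith) (by linarith)
  have S2 := chord_slope_mono hψ (x := -b) (y := -b + ε) (x' := -(b / 2)) (y' := 0) (by linarith)
    (by linarith) (by linarith) (by linarith)
  rw [sub_zero, sub_sub_cancel, div_le_div_iff₀ hb2 hε] at S1
  rw [add_sub_cancel_left, zero_sub, neg_neg, div_le_div_iff₀ hε hb2] at S2
  have hS : (f u - 4 * (L * σ) / b) * (b / 2) = b / 2 * f u - 2 * (L * σ) := by field_simp; ring
  have hS' : (-f (-u) + 4 * (L * σ) / b) * (b / 2) = -(b / 2 * f (-u)) + 2 * (L * σ) := by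
    field_simp; ring
  refine sq_mul_le_integral_excessDiff_of_rise hψ (hf.continuous_line w u) hL
    (hf.abs_line_sub_le w hu) (p := β + g) (S := f u - 4 * (L * σ) / b)
    (S' := -f (-u) + 4 * (L * σ) / b) (M := M) (β := β)
    (by linarith) hε hτ (by linarith) ?_ ?_ hM0 ?_ (by rw [add_sub_cancel_left]; exact hε2)
    ?_ ?_ ?_
  · refine le_of_mul_le_mul_right ?_ hb2
    have e := (near (b / 2) hb2.le).2
    calc _ ≤ _ := S2
      _ ≤ (2 * (L * σ) - b / 2 * f (-u)) * ε := mul_le_mul_of_nonneg_right (by linarith) hε.le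
      _ = (-f (-u) + 4 * (L * σ) / b) * (b / 2) * ε := by rw [hS']; ring
      _ = _ := by ring
  · refine le_of_mul_le_mul_right ?_ hb2
    have e := (near (b / 2) hb2.le).1
    refine le_trans ?_ S1
    calc _ = (f u - 4 * (L * σ) / b) * (b / 2) * ε := by ring
      _ = (b / 2 * f u - 2 * (L * σ)) * ε := by rw [hS]
      _ ≤ _ := mul_le_mul_of_nonneg_right (by linarith) hε.le
  · have e := (near b hb0.le).1
    have := mul_le_mul_of_nonneg_left hfu hb0.le
    rw [hM] at hσ2 ⊢
    linarith
  · have := hw u hu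
    have e : 8 * (L * σ) / b = 2 * (4 * (L * σ) / b) := by ring
    exact (min_le_left _ _).trans (by linarith)
  · refine (min_le_right _ _).trans ((min_le_left _ _).trans ?_)
    have : μ = β + 4 * g := by rw [hg]; ring
    linarith
  · refine (min_le_right _ _).trans ((min_le_right _ _).trans ?_)
    rw [add_sub_cancel_left]

/-- Lower bound in directions transversal to a direction `t` along which `f` has a kink. -/
theorem exists_lower_bound_of_kink (hf : IsLipschitzSublinear f L) {η₀ ρ μ : ℝ} {t : E s}
    (ht : ‖t‖ = 1) (hη₀ : 0 < η₀) (hρ : 0 < ρ) (htρ : η₀ < ρ * f t) (hμ : μ < f t)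
    (hkink : ∀ u : E s, (∀ c : ℝ, u ≠ c • t) → 2 * f t < f (t + u) + f (t - u)) :
    ∃ k : ℝ, 0 < k ∧ ∃ ε₀ : ℝ, 0 < ε₀ ∧ ∀ (u : E s) (τ η ε : ℝ), ‖u‖ = 1 → f u ≤ μ →
      f (-u) ≤ μ → η ≤ η₀ → 0 < ε → ε ≤ ε₀ →
      k * ε ^ 2 ≤ ∫ z in Metric.ball (0 : E s) ρ, excessDiffAlong f u τ η ε z := by
  have hL := hf.pos
  have hft : 0 < f t := by
    by_contra! h
    nlinarith
  obtain ⟨h, hh1, hh2⟩ : ∃ h, η₀ / f t < h ∧ h < ρ := exists_between ((div_lt_iff₀ hft).2 htρ)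
  have hh0 : 0 < h := (by positivity : 0 < η₀ / f t).trans hh1
  rw [div_lt_iff₀ hft] at hh1
  -- The ball of radius 3l around h • t stays inside radius ρ and in the region where f ≥ η₀.
  obtain ⟨l, hl0, hl1, hl2⟩ : ∃ l, 0 < l ∧ l ≤ (ρ - h) / 3 ∧ l ≤ (h * f t - η₀) / (3 * L) := by
    have h1 : 0 < ρ - h := sub_pos.2 hh2
    have h2 : 0 < h * f t - η₀ := sub_pos.2 hh1
    exact ⟨min ((ρ - h) / 3) ((h * f t - η₀) / (3 * L)), by positivity, min_le_left _ _,
      min_le_right _ _⟩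
  rw [le_div_iff₀ (by positivity)] at hl2
  let A : Set (E s) := {u | ‖u‖ = 1 ∧ f u ≤ μ ∧ f (-u) ≤ μ}
  have hfc := hf.continuous
  have hA : IsCompact A := by
    refine (isCompact_sphere (0 : E s) 1).of_isClosed_subset ?_ fun u hu => by
      simpa using hu.1
    exact (isClosed_eq continuous_norm continuous_const).inter
      ((isClosed_le hfc continuous_const).inter
        (isClosed_le (hfc.comp continuous_neg) continuous_const))
  let F : E s → ℝ := fun u => f (h • t + l • u) + f (h • t - l • u) - 2 * f (h • t)
  have hFpos : ∀ u ∈ A, 0 < F u := by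
    rintro u ⟨hu1, hu2, hu3⟩
    -- A unit multiple of t is ±t, which is excluded since f(u), f(-u) ≤ μ < f(t).
    have hne : ∀ c : ℝ, (l / h) • u ≠ c • t := by
      intro c hc
      have hu : u = (h / l * c) • t := by
        rw [mul_smul, ← hc, smul_smul, div_mul_div_cancel₀ hl0.ne', div_self hh0.ne', one_smul]
      have habs : |h / l * c| = 1 := by
        rw [hu, norm_smul, ht, mul_one, Real.norm_eq_abs] at hu1
        exact hu1
      rcases eq_or_eq_neg_of_abs_eq habs with e | e
      · rw [hu, e, one_smul] at hu2
        linarith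
      · rw [hu, e, neg_smul, one_smul, neg_neg] at hu3
        linarith
    have h1 := mul_lt_mul_of_pos_left (hkink _ hne) hh0
    have e1 : h • t + l • u = h • (t + (l / h) • u) := by
      rw [smul_add, smul_smul, mul_div_cancel₀ _ hh0.ne']
    have e2 : h • t - l • u = h • (t - (l / h) • u) := by
      rw [smul_sub, smul_smul, mul_div_cancel₀ _ hh0.ne']
    simp only [F]
    rw [e1, e2, hf.smul h hh0.le, hf.smul h hh0.le, hf.smul h hh0.le]
    linarith
  obtain ⟨ω, hω0, hω⟩ : ∃ ω : ℝ, 0 < ω ∧ ∀ u ∈ A, ω ≤ F u := by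
    rcases A.eq_empty_or_nonempty with hAe | hAne
    · exact ⟨1, one_pos, by simp [hAe]⟩
    · obtain ⟨u, hu, hmin⟩ := hA.exists_isMinOn hAne (f := F) (by fun_prop)
      exact ⟨F u, hFpos u hu, fun v hv => hmin hv⟩
  -- Moving the base point by σ changes the second difference by at most 4Lσ ≤ ω/2, so half of the
  -- uniform kink ω survives.
  obtain ⟨σ, hσ0, hσ1, hσ2⟩ : ∃ σ, 0 < σ ∧ σ ≤ l ∧ σ ≤ ω / (8 * L) :=
    ⟨min l (ω / (8 * L)), by positivity, min_le_left _ _, min_le_right _ _⟩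
  rw [le_div_iff₀ (by positivity)] at hσ2
  obtain ⟨k', hk', H⟩ := hf.exists_lower_bound_of_line (z₀ := h • t) (ρ := ρ)
    (a := -(2 * l)) (b := 2 * l) (k := ω / (2 * l)) (by linarith) hσ0 (by positivity)
  refine ⟨k', hk', l, hl0, ?_⟩
  intro u τ η ε hu hu2 hu3 hη hε hε₀
  have hdist : ∀ w ∈ Metric.ball (h • t) σ, ∀ x ∈ Set.Icc (-(2 * l)) (2 * l),
      ‖w + x • u - h • t‖ < 3 * l := by
    intro w hw x hx
    rw [mem_ball_iff_norm] at hw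
    calc ‖w + x • u - h • t‖ = ‖(w - h • t) + x • u‖ := by congr 1; abel
      _ ≤ ‖w - h • t‖ + ‖x • u‖ := norm_add_le _ _
      _ ≤ ‖w - h • t‖ + 2 * l := by
        rw [norm_smul, hu, mul_one, Real.norm_eq_abs]
        gcongr
        exact abs_le.2 hx
      _ < 3 * l := by linarith
  refine H u τ η ε (fun w hw x hx => ?_) fun w hw => ?_
  · rw [mem_ball_zero_iff]
    have h1 := norm_add_le (w + x • u - h • t) (h • t)
    rw [sub_add_cancel, norm_smul, ht, mul_one, Real.norm_of_nonneg hh0.le] at h1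
    have := hdist w hw x hx
    linarith
  have hψ := hf.convexOn_line w u
  have S1 := chord_slope_mono hψ (x := 0) (y := l) (x' := 2 * l - ε) (y' := 2 * l) hl0
    (by linarith) (by linarith) (by linarith)
  have S2 := chord_slope_mono hψ (x := -(2 * l)) (y := -(2 * l) + ε) (x' := -l) (y' := 0)
    (by linarith) (by linarith) (by linarith) (by linarith)
  rw [sub_zero, sub_sub_cancel, le_div_iff₀ hε] at S1
  rw [add_sub_cancel_left, zero_sub, neg_neg, div_le_iff₀ hε] at S2
  refine le_trans (mul_le_mul_of_nonneg_right ?_ (sq_nonneg ε))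
    (sq_mul_le_integral_excessDiff hψ (hf.continuous_line w u) (by linarith) hε ?_ S2 S1)
  · have a1 := (abs_le.1 (hf.abs_add_sub_le hw (l • u))).1
    have a2 := (abs_le.1 (hf.abs_add_sub_le hw ((-l) • u))).1
    have a3 := (abs_le.1 (hf.abs_add_sub_le hw ((0 : ℝ) • u))).2
    have a4 := hω u ⟨hu, hu2, hu3⟩
    simp only [F, sub_eq_add_neg, ← neg_smul] at a4
    rw [zero_smul, add_zero, add_zero] at a3
    rw [zero_smul, add_zero, ← sub_div, div_le_div_iff₀ (by positivity) hl0]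
    have : ω ≤ 2 * (f (w + l • u) - f w - (f w - f (w + (-l) • u))) := by linarith
    nlinarith
  · intro x hx
    have h1 := hf.le_add (h • t) (w + x • u)
    have h2 := mul_le_mul_of_nonneg_left (hdist w hw x hx).le hL.le
    rw [norm_sub_rev, hf.smul h hh0.le] at h1
    linarith

/-- The level μ separates steep directions from those transversal to t; the case of steep -u reduces
to that of u by reversing (u, τ). The bounds on τ are required only where f is positive, which is
all that admissibility can provide. -/
theorem exists_lower_bound (hf : IsLipschitzSublinear f L) {η₀ ρ β ω : ℝ} {t : E s}
    (hη₀ : 0 < η₀) (hρ : 0 < ρ) (hβ : 0 ≤ β) (hω : 0 < ω)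
    (hw : ∀ u, ‖u‖ = 1 → ω ≤ f u + f (-u)) (ht : ‖t‖ = 1) (htρ : η₀ < ρ * f t) (htβ : β < f t)
    (hkink : ∀ u : E s, (∀ c : ℝ, u ≠ c • t) → 2 * f t < f (t + u) + f (t - u)) :
    ∃ k : ℝ, 0 < k ∧ ∃ ε₀ : ℝ, 0 < ε₀ ∧ ∀ (u : E s) (τ η ε : ℝ), ‖u‖ = 1 →
      (0 < f u → -β ≤ τ) → (0 < f (-u) → τ ≤ β) → η ≤ η₀ → 0 < ε → ε ≤ ε₀ →
      k * ε ^ 2 ≤ ∫ z in Metric.ball (0 : E s) ρ, excessDiffAlong f u τ η ε z := by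
  obtain ⟨μ, hμ1, hμ2⟩ : ∃ μ, max β (η₀ / ρ) < μ ∧ μ < f t :=
    exists_between (max_lt htβ ((div_lt_iff₀' hρ).2 htρ))
  have hβμ := (le_max_left _ _).trans_lt hμ1
  have hμ3 := (div_lt_iff₀' hρ).1 ((le_max_right _ _).trans_lt hμ1)
  have hμ0 := hβ.trans_lt hβμ
  obtain ⟨k₁, hk₁, ε₁, hε₁, H₁⟩ :=
    hf.exists_lower_bound_of_steep hη₀ hβ hβμ hμ3 hω hw
  obtain ⟨k₂, hk₂, ε₂, hε₂, H₂⟩ := hf.exists_lower_bound_of_kink ht hη₀ hρ htρ hμ2 hkink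
  refine ⟨min k₁ k₂, by positivity, min ε₁ ε₂, by positivity, ?_⟩
  intro u τ η ε hu hτ1 hτ2 hη hε hε₀
  have hle1 := hε₀.trans (min_le_left _ _)
  have hle2 := hε₀.trans (min_le_right _ _)
  have hm1 := mul_le_mul_of_nonneg_right (min_le_left k₁ k₂) (sq_nonneg ε)
  have hm2 := mul_le_mul_of_nonneg_right (min_le_right k₁ k₂) (sq_nonneg ε)
  by_cases hu1 : μ ≤ f u
  · exact hm1.trans (H₁ u τ η ε hu hu1 (hτ1 (by linarith)) hη hε hle1)
  by_cases hu2 : μ ≤ f (-u)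
  · have := H₁ (-u) (-τ) η ε (by rwa [norm_neg]) hu2 (neg_le_neg (hτ2 (by linarith))) hη hε hle1
    simp only [excessDiffAlong_neg] at this
    exact hm1.trans this
  exact hm2.trans (H₂ u τ η ε hu (not_le.1 hu1).le (not_le.1 hu2).le hη hε hle2)

end IsLipschitzSublinear

theorem exists_isLipschitzSublinear_phi {W : Matrix (Fin s) (Fin m) ℝ} {q : Fin m → ℝ}
    (h1 : CompleteRecourse W) (h2 : ExpensiveRecourse W q) :
    ∃ L, IsLipschitzSublinear (phi W q) L := by
  obtain ⟨L, hL, h⟩ := phi_le_add_norm h1 h2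
  exact ⟨L, hL, phi_add_le h1 h2, fun c hc x => phi_smul h1 h2 hc x, h⟩

/-! ### From local midpoint inequalities to chords. -/

/-- A continuous function which is locally midpoint convex lies below its chords. -/
theorem le_chord_of_local_midpoint {H : ℝ → ℝ} (hH : Continuous H) {ε₀ : ℝ} (hε₀ : 0 < ε₀)
    (hmid : ∀ x ε : ℝ, 0 < ε → ε ≤ ε₀ → 0 ≤ x - ε → x + ε ≤ 1 → 2 * H x ≤ H (x + ε) + H (x - ε))
    {l : ℝ} (hl : l ∈ Set.Icc (0 : ℝ) 1) : H l ≤ (1 - l) * H 0 + l * H 1 := by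
  by_contra! hcon
  let J : ℝ → ℝ := fun x => H x - ((1 - x) * H 0 + x * H 1)
  have hJ : Continuous J := by fun_prop
  have hJl : 0 < J l := sub_pos.2 hcon
  obtain ⟨x₁, hx₁, hmax⟩ := isCompact_Icc.exists_isMaxOn ⟨l, hl⟩ hJ.continuousOn
  have hM : 0 < J x₁ := hJl.trans_le (hmax hl)
  have hcpt : IsCompact (Set.Icc (0 : ℝ) 1 ∩ {x | J x = J x₁}) :=
    isCompact_Icc.inter_right (isClosed_eq hJ continuous_const)
  -- Take the leftmost maximizer of the excess over the chord: it is interior and its left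
  -- neighbours are strictly smaller, contradicting the midpoint inequality.
  obtain ⟨x, ⟨hx, hxM⟩, hleast⟩ := hcpt.exists_isLeast ⟨x₁, hx₁, rfl⟩
  have hxM : J x = J x₁ := hxM
  have hx0 : 0 < x := lt_of_le_of_ne hx.1 (by
    rintro rfl
    simp only [J] at hxM hM
    linarith)
  have hx1 : x < 1 := lt_of_le_of_ne hx.2 (by
    rintro rfl
    simp only [J] at hxM hM
    linarith)
  obtain ⟨ε, hε, h1, h2, h3⟩ : ∃ ε, 0 < ε ∧ ε ≤ ε₀ ∧ ε ≤ x ∧ ε ≤ 1 - x := by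
    have := sub_pos.2 hx1
    exact ⟨min ε₀ (min x (1 - x)), by positivity, min_le_left _ _,
      (min_le_right _ _).trans (min_le_left _ _), (min_le_right _ _).trans (min_le_right _ _)⟩
  have e1 := hmid x ε hε h1 (by linarith) (by linarith)
  have e2 : J (x + ε) ≤ J x₁ := hmax ⟨by linarith, by linarith⟩
  have hm : x - ε ∈ Set.Icc (0 : ℝ) 1 := ⟨by linarith, by linarith⟩
  have e3 : J (x - ε) < J x₁ := lt_of_le_of_ne (hmax hm) fun h => by
    have := hleast ⟨hm, h⟩
    linarith
  simp only [J] at e2 e3 hxM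
  linarith

/-! ### Use of the density bound. -/

/-- The density condition bounds `μ` from below on the balls with centre in `V`. -/
theorem DensityCondition.smul_restrict_le {μ : Measure (E s)} {V : Set (E s)} {r ρ : ℝ}
    (h : DensityCondition μ V r ρ) {x : E s} (hx : x ∈ V) :
    ENNReal.ofReal r • volume.restrict (Metric.ball x ρ) ≤ μ := by
  obtain ⟨θ, hθ, rfl, hle⟩ := h
  have hsub : Metric.ball x ρ ⊆ V + Metric.ball (0 : E s) ρ := fun z hz =>
    ⟨x, hx, z - x, by rwa [mem_ball_zero_iff, ← mem_ball_iff_norm], by simp⟩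
  refine Measure.le_iff.2 fun S hS => ?_
  rw [Measure.smul_apply, Measure.restrict_apply hS, smul_eq_mul, withDensity_apply _ hS]
  calc ENNReal.ofReal r * volume (S ∩ Metric.ball x ρ)
      = ∫⁻ _z in S ∩ Metric.ball x ρ, ENNReal.ofReal r := by simp
    _ ≤ ∫⁻ z in S ∩ Metric.ball x ρ, θ z :=
        lintegral_mono_ae (ae_mono (Measure.restrict_mono (Set.inter_subset_right.trans hsub)
          le_rfl) hle)
    _ ≤ ∫⁻ z in S, θ z := lintegral_mono_set Set.inter_subset_left

theorem DensityCondition.mul_setIntegral_le {μ : Measure (E s)} {V : Set (E s)} {r ρ : ℝ}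
    (h : DensityCondition μ V r ρ) (hr : 0 ≤ r) {x : E s} (hx : x ∈ V) {g : E s → ℝ}
    (hg : ∀ z, 0 ≤ g z) (hi : Integrable (fun z => g (z - x)) μ) :
    r * ∫ z in Metric.ball (0 : E s) ρ, g z ≤ ∫ z, g (z - x) ∂μ := by
  have h1 := integral_mono_measure (h.smul_restrict_le hx)
    (Filter.Eventually.of_forall fun z => hg (z - x)) hi
  rw [integral_smul_measure, ENNReal.toReal_ofReal hr, smul_eq_mul] at h1
  have e1 : ∫ z in Metric.ball x ρ, g (z - x) = ∫ z in Metric.ball (0 : E s) ρ, g z := by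
    have := (measurePreserving_sub_right (volume : Measure (E s)) x).setIntegral_preimage_emb
      (MeasurableEquiv.subRight x).measurableEmbedding g (Metric.ball 0 ρ)
    rw [← this]
    congr 2
    ext z
    simp [dist_eq_norm]
  rwa [e1] at h1

/-! ### Second differences and partial moduli of the expected excess. -/

section ExpectedExcess

variable {W : Matrix (Fin s) (Fin m) ℝ} {q : Fin m → ℝ} {μ : Measure (E s)}
  [IsProbabilityMeasure μ] {L : ℝ}

theorem integrable_phi_sub (hf : IsLipschitzSublinear (phi W q) L)
    (hμ : Integrable (fun z : E s => ‖z‖) μ) (x : E s) :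
    Integrable (fun z => phi W q (z - x)) μ := by
  have hc := hf.continuous
  refine ((hμ.add (integrable_const ‖x‖)).const_mul L).mono'
    (Continuous.aestronglyMeasurable (by fun_prop)) (Filter.Eventually.of_forall fun z => ?_)
  have h0 : phi W q 0 = 0 := by simpa using hf.smul 0 le_rfl 0
  have := hf.abs_sub_le (z - x) 0
  rw [h0, sub_zero, sub_zero] at this
  exact this.trans (mul_le_mul_of_nonneg_left (norm_sub_le z x) hf.pos.le)

theorem integrable_excess (hf : IsLipschitzSublinear (phi W q) L)
    (hμ : Integrable (fun z : E s => ‖z‖) μ) (p : E s × ℝ) :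
    Integrable (fun z => max 0 (phi W q (z - p.1) - p.2)) μ :=
  (integrable_const 0).sup ((integrable_phi_sub hf hμ p.1).sub (integrable_const p.2))

theorem continuous_QEE (hf : IsLipschitzSublinear (phi W q) L)
    (hμ : Integrable (fun z : E s => ‖z‖) μ) : Continuous (QEE W q μ) := by
  have hL := hf.pos
  refine (LipschitzWith.of_le_add_mul (L + 1).toNNReal fun p p' => ?_).continuous
  rw [Real.coe_toNNReal _ (by positivity)]
  have h1 : QEE W q μ p ≤
      ∫ z, (max 0 (phi W q (z - p'.1) - p'.2) + (L + 1) * dist p p') ∂μ := by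
    refine integral_mono (integrable_excess hf hμ p)
      ((integrable_excess hf hμ p').add (integrable_const _)) fun z => ?_
    have e1 : ‖p.1 - p'.1‖ ≤ dist p p' := by
      rw [dist_eq_norm]; exact norm_fst_le (p - p')
    have e2 : |p.2 - p'.2| ≤ dist p p' := by
      rw [dist_eq_norm]; exact norm_snd_le (p - p')
    have e3 := hf.le_add (z - p.1) (z - p'.1)
    rw [sub_sub_sub_cancel_left, norm_sub_rev] at e3
    have e4 := mul_le_mul_of_nonneg_left e1 hL.le
    have e5 := (abs_le.1 e2).1
    have e6 : 0 ≤ dist p p' := dist_nonneg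
    have e7 := le_max_left 0 (phi W q (z - p'.1) - p'.2)
    have e8 := le_max_right 0 (phi W q (z - p'.1) - p'.2)
    refine max_le (by positivity) ?_
    linarith
  rw [integral_add (integrable_excess hf hμ p') (integrable_const _), integral_const] at h1
  simpa [QEE] using h1

theorem excessDiffAlong_sub (f : E s → ℝ) (u x z : E s) (τ η ε : ℝ) :
    excessDiffAlong f u τ η ε (z - x) =
      max 0 (f (z - ((x, η) + ε • (u, τ)).1) - ((x, η) + ε • (u, τ)).2) +
        max 0 (f (z - ((x, η) - ε • (u, τ)).1) - ((x, η) - ε • (u, τ)).2) -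
        2 * max 0 (f (z - x) - η) := by
  have e1 : z - x + (0 - ε) • u = z - (x + ε • u) := by module
  have e2 : z - x + (0 + ε) • u = z - (x - ε • u) := by module
  unfold excessDiffAlong excessDiff
  simp only [e1, e2, zero_smul, add_zero, Prod.fst_add, Prod.snd_add, Prod.fst_sub, Prod.snd_sub,
    Prod.smul_fst, Prod.smul_snd, smul_eq_mul, sub_add_eq_sub_sub, ← sub_add]

theorem integrable_excessDiffAlong_sub (hf : IsLipschitzSublinear (phi W q) L)
    (hμ : Integrable (fun z : E s => ‖z‖) μ) (u x : E s) (τ η ε : ℝ) :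
    Integrable (fun z => excessDiffAlong (phi W q) u τ η ε (z - x)) μ := by
  simp only [excessDiffAlong_sub]
  exact ((integrable_excess hf hμ _).add (integrable_excess hf hμ _)).sub
    ((integrable_excess hf hμ (x, η)).const_mul 2)

theorem integral_excessDiffAlong_sub (hf : IsLipschitzSublinear (phi W q) L)
    (hμ : Integrable (fun z : E s => ‖z‖) μ) (u x : E s) (τ η ε : ℝ) :
    ∫ z, excessDiffAlong (phi W q) u τ η ε (z - x) ∂μ =
      QEE W q μ ((x, η) + ε • (u, τ)) + QEE W q μ ((x, η) - ε • (u, τ))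
        - 2 * QEE W q μ (x, η) := by
  simp only [excessDiffAlong_sub]
  have hC := integrable_excess hf hμ (x, η)
  have hA := integrable_excess hf hμ ((x, η) + ε • (u, τ))
  have hB := integrable_excess hf hμ ((x, η) - ε • (u, τ))
  refine (integral_sub (hA.add hB) (hC.const_mul 2)).trans ?_
  rw [integral_const_mul]
  exact congrArg (· - _) (integral_add hA hB)

/-- A lower bound on the second differences along a segment gives a strong convexity
inequality on this segment. -/
theorem QEE_segment_le (hf : IsLipschitzSublinear (phi W q) L)
    (hμ : Integrable (fun z : E s => ‖z‖) μ) {p₁ p₂ : E s × ℝ} {c ε₀ l : ℝ} (hε₀ : 0 < ε₀)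
    (h : ∀ x ε : ℝ, 0 < ε → ε ≤ ε₀ → 0 ≤ x → x ≤ 1 →
      2 * c * ε ^ 2 ≤ QEE W q μ (p₂ + x • (p₁ - p₂) + ε • (p₁ - p₂)) +
        QEE W q μ (p₂ + x • (p₁ - p₂) - ε • (p₁ - p₂)) - 2 * QEE W q μ (p₂ + x • (p₁ - p₂)))
    (hl0 : 0 ≤ l) (hl1 : l ≤ 1) :
    QEE W q μ (l • p₁ + (1 - l) • p₂) ≤
      l * QEE W q μ p₁ + (1 - l) * QEE W q μ p₂ - c * l * (1 - l) := by
  have hc := continuous_QEE hf hμ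
  -- Subtracting c x² removes exactly 2cε² from the second difference.
  have := le_chord_of_local_midpoint
    (H := fun x => QEE W q μ (p₂ + x • (p₁ - p₂)) - c * x ^ 2) (by fun_prop) hε₀
    (fun x ε hε h1 h2 h3 => by
      have := h x ε hε h1 (by linarith) (by linarith)
      have e1 : p₂ + (x + ε) • (p₁ - p₂) = p₂ + x • (p₁ - p₂) + ε • (p₁ - p₂) := by module
      have e2 : p₂ + (x - ε) • (p₁ - p₂) = p₂ + x • (p₁ - p₂) - ε • (p₁ - p₂) := by module
      rw [e1, e2]
      linarith) (l := l) ⟨hl0, hl1⟩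
  simp only [zero_smul, one_smul, add_zero, add_sub_cancel] at this
  rw [show p₂ + l • (p₁ - p₂) = l • p₁ + (1 - l) • p₂ by module] at this
  nlinarith

theorem exists_isPartialModulus (h1 : CompleteRecourse W) (h2 : ExpensiveRecourse W q)
    {r ρ η₀ δ : ℝ} (hr : 0 < r) (hρ : 0 < ρ) (hη₀ : 0 < η₀) (hA5 : ThresholdCondition W q η₀ ρ)
    (hδ : IsDelta W q δ) :
    ∃ κ : ℝ, 0 < κ ∧ ∀ (V : Set (E s)) (μ : Measure (E s)) [IsProbabilityMeasure μ],
      Convex ℝ V → Integrable (fun z : E s => ‖z‖) μ → DensityCondition μ V r ρ →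
      IsPartialModulus W q μ V η₀ δ κ := by
  obtain ⟨L, hf⟩ := exists_isLipschitzSublinear_phi h1 h2
  obtain ⟨ω, hω, hw⟩ := exists_pos_le_phi_add_phi_neg h1 h2
  obtain ⟨t, ht, hδ0, hδt, htρ, hkink⟩ := hδ.exists_direction h1 h2 hη₀ hA5
  obtain ⟨k, hk, ε₀, hε₀, H⟩ := hf.exists_lower_bound (β := δ / 3) hη₀ hρ (by positivity) hω hw
    ht htρ (by linarith) hkink
  refine ⟨r * k, by positivity, fun V μ _ hV hμ hd Ω hΩ p₁ hp₁ p₂ hp₂ l hl0 hl1 => ?_⟩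
  -- If the x-components agree there is no direction to normalize, and plain convexity is enough.
  rcases (norm_nonneg (p₁.1 - p₂.1)).eq_or_lt with hN | hN
  · have := QEE_segment_le hf hμ (p₁ := p₁) (p₂ := p₂) (c := 0) one_pos
      (fun x ε _ _ _ _ => by
        rw [mul_zero, zero_mul,
          ← integral_excessDiffAlong_sub hf hμ (p₁ - p₂).1 _ (p₁ - p₂).2 _ ε]
        exact integral_nonneg fun z => hf.excessDiffAlong_nonneg _ _ _ _ _) hl0.le hl1.le
    rw [← hN]
    linarith
  set N := ‖p₁.1 - p₂.1‖ with hNdef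
  set u : E s := N⁻¹ • (p₁.1 - p₂.1) with hu
  set τ : ℝ := N⁻¹ * (p₁.2 - p₂.2) with hτ
  have hu1 : ‖u‖ = 1 := by
    rw [hu, norm_smul, norm_inv, Real.norm_of_nonneg hN.le, ← hNdef, inv_mul_cancel₀ hN.ne']
  have hdir : p₁ - p₂ = N • (u, τ) := by
    refine Prod.ext ?_ ?_
    · simp [hu, smul_smul, mul_inv_cancel₀ hN.ne']
    · simp [hτ, mul_inv_cancel_left₀ hN.ne']
  have hN0 : 0 < N⁻¹ := inv_pos.2 hN
  -- Where φ(u) > 0, the difference lies in some K_i with i ∈ I⁺, so admissibility bounds τ.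
  -- Exchanging the two points gives the bound for -u.
  have hτ1 : 0 < phi W q u → -(δ / 3) ≤ τ := fun hpos => by
    rw [hu, hf.smul _ hN0.le] at hpos
    obtain ⟨d, hd, hmem⟩ := exists_mem_linCone_of_phi_pos h1 h2 (pos_of_mul_pos_right hpos hN0.le)
    have := hΩ.2 p₂ hp₂ p₁ hp₁ d hd hmem
    rw [hτ, ← div_eq_inv_mul, le_div_iff₀ hN]
    exact this
  have hτ2 : 0 < phi W q (-u) → τ ≤ δ / 3 := fun hpos => by
    rw [hu, ← smul_neg, neg_sub, hf.smul _ hN0.le] at hpos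
    obtain ⟨d, hd, hmem⟩ := exists_mem_linCone_of_phi_pos h1 h2 (pos_of_mul_pos_right hpos hN0.le)
    have := hΩ.2 p₁ hp₁ p₂ hp₂ d hd hmem
    rw [norm_sub_rev] at this
    rw [hτ, ← div_eq_inv_mul, div_le_iff₀ hN]
    linarith
  have key := QEE_segment_le hf hμ (p₁ := p₁) (p₂ := p₂) (c := r * k / 2 * N ^ 2) (l := l)
    (ε₀ := ε₀ / N) (by positivity) (fun x ε hε hle hx0 hx1 => by
      have hp1 := hΩ.1 hp₁
      have hp2 := hΩ.1 hp₂
      set p := p₂ + x • (p₁ - p₂) with hp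
      have hpe : p = x • p₁ + (1 - x) • p₂ := by rw [hp]; module
      have hpV : p.1 ∈ V := by
        rw [hpe]
        exact hV hp1.1 hp2.1 hx0 (by linarith) (by linarith)
      have hpη : p.2 ≤ η₀ := by
        rw [hpe]
        exact (convex_Iic η₀) hp1.2 hp2.2 hx0 (by linarith) (by linarith)
      rw [hdir, smul_smul]
      have e1 := integral_excessDiffAlong_sub hf hμ u p.1 τ p.2 (ε * N)
      rw [Prod.mk.eta] at e1
      rw [← e1]
      refine le_trans ?_ (hd.mul_setIntegral_le hr.le hpV
        (hf.excessDiffAlong_nonneg u τ p.2 (ε * N))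
        (integrable_excessDiffAlong_sub hf hμ u p.1 τ p.2 (ε * N)))
      have e2 := H u τ p.2 (ε * N) hu1 hτ1 hτ2 hpη (by positivity) ((le_div_iff₀ hN).1 hle)
      have e3 := mul_le_mul_of_nonneg_left e2 hr.le
      calc _ = r * (k * (ε * N) ^ 2) := by ring
        _ ≤ _ := e3) hl0.le hl1.le
  linarith

/-! ### Conditional value-at-risk -/

/-- With `le_max_sub_sub_max`, this bounds the change of the expected excess between two thresholds
by tail probabilities, replacing differentiation in η. -/
theorem max_sub_sub_max_le {X t η : ℝ} (h : t ≤ η) :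
    max 0 (X - t) - max 0 (X - η) ≤ Set.indicator (Set.Ioi t) (fun _ => η - t) X := by
  by_cases hX : X ∈ Set.Ioi t
  · rw [Set.indicator_of_mem hX]
    rcases max_cases 0 (X - t) with ⟨e, _⟩ | ⟨e, _⟩ <;>
      rcases max_cases 0 (X - η) with ⟨e', _⟩ | ⟨e', _⟩ <;> linarith
  · rw [Set.indicator_of_notMem hX]
    have hX : X ≤ t := not_lt.1 hX
    rw [max_eq_left (by linarith), max_eq_left (by linarith), sub_zero]

theorem le_max_sub_sub_max {X t η : ℝ} (h : η ≤ t) :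
    Set.indicator (Set.Ioi t) (fun _ => t - η) X ≤ max 0 (X - η) - max 0 (X - t) := by
  by_cases hX : X ∈ Set.Ioi t
  · rw [Set.indicator_of_mem hX]
    have hX : t < X := hX
    rw [max_eq_right (by linarith), max_eq_right (by linarith)]
    linarith
  · rw [Set.indicator_of_notMem hX]
    exact sub_nonneg.2 (max_le_max le_rfl (by linarith))

theorem integral_indicator_phi (hf : IsLipschitzSublinear (phi W q) L) (x : E s) (t c : ℝ) :
    Integrable (fun z => Set.indicator (Set.Ioi t) (fun _ => c) (phi W q (z - x))) μ ∧
    ∫ z, Set.indicator (Set.Ioi t) (fun _ => c) (phi W q (z - x)) ∂μ =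
      (1 - μ.real {z | phi W q (z - x) ≤ t}) * c := by
  have hc := hf.continuous
  have hcl : IsClosed {z | phi W q (z - x) ≤ t} := isClosed_le (by fun_prop) continuous_const
  have hms : MeasurableSet {z | phi W q (z - x) ≤ t}ᶜ := hcl.measurableSet.compl
  have e : (fun z => Set.indicator (Set.Ioi t) (fun _ => c) (phi W q (z - x))) =
      Set.indicator {z | phi W q (z - x) ≤ t}ᶜ fun _ => c := by
    ext z
    by_cases h : t < phi W q (z - x)
    · rw [Set.indicator_of_mem (show phi W q (z - x) ∈ Set.Ioi t from h),
        Set.indicator_of_mem (show z ∈ {z | phi W q (z - x) ≤ t}ᶜ from not_le.2 h)]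
    · rw [Set.indicator_of_notMem (show phi W q (z - x) ∉ Set.Ioi t from h),
        Set.indicator_of_notMem (show z ∉ {z | phi W q (z - x) ≤ t}ᶜ from
          fun h' => h (not_le.1 h'))]
  rw [e]
  refine ⟨(integrable_const c).indicator hms, ?_⟩
  rw [integral_indicator_const c hms, probReal_compl_eq_one_sub hcl.measurableSet, smul_eq_mul]

/-- The value-at-risk minimises `η ↦ η + Q_EE(x, η) / α`. -/
theorem QVaR_add_QEE_le (hf : IsLipschitzSublinear (phi W q) L)
    (hμ : Integrable (fun z : E s => ‖z‖) μ) {α : ℝ} (hα0 : 0 < α) (hα1 : α < 1) (x : E s)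
    (η : ℝ) :
    QVaR W q μ α x + 1 / α * QEE W q μ (x, QVaR W q μ α x) ≤ η + 1 / α * QEE W q μ (x, η) := by
  set T : Set ℝ := {t : ℝ | 1 - α ≤ μ.real {z | phi W q (z - x) ≤ t}} with hT
  set v := QVaR W q μ α x with hv
  have hvT : v = sInf T := rfl
  have hc := hf.continuous
  have hQ := continuous_QEE hf hμ
  have hX : Measurable fun z => phi W q (z - x) := Continuous.measurable (by fun_prop)
  have := Measure.isProbabilityMeasure_map (μ := μ) hX.aemeasurable
  have hcdf : ∀ t, ProbabilityTheory.cdf (μ.map fun z => phi W q (z - x)) t =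
      μ.real {z | phi W q (z - x) ≤ t} := fun t => by
    rw [ProbabilityTheory.cdf_eq_real, map_measureReal_apply hX measurableSet_Iic]
    rfl
  have hmono : ∀ t ∈ T, ∀ t', t ≤ t' → t' ∈ T := fun t ht t' htt' =>
    le_trans (show 1 - α ≤ _ from ht) (measureReal_mono fun z (hz : _ ≤ t) => hz.trans htt')
  have hne : T.Nonempty := by
    obtain ⟨t, ht⟩ := ((ProbabilityTheory.tendsto_cdf_atTop
      (μ.map fun z => phi W q (z - x))).eventually_const_le (by linarith : 1 - α < 1)).exists
    exact ⟨t, by rwa [hcdf] at ht⟩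
  have hbdd : BddBelow T := by
    obtain ⟨t, ht⟩ := ((ProbabilityTheory.tendsto_cdf_atBot
      (μ.map fun z => phi W q (z - x))).eventually_lt_const (by linarith : 0 < 1 - α)).exists
    rw [hcdf] at ht
    exact ⟨t, fun t' ht' => not_lt.1 fun hlt => absurd (hmono t' ht' t hlt.le) (not_le.2 ht)⟩
  have hg : Continuous fun η : ℝ => η + 1 / α * QEE W q μ (x, η) := by fun_prop
  have hup : ∀ t ∈ T, t ≤ η → t + 1 / α * QEE W q μ (x, t) ≤ η + 1 / α * QEE W q μ (x, η) := by
    intro t ht hle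
    obtain ⟨hi, he⟩ := integral_indicator_phi (μ := μ) hf x t (η - t)
    have h1 : QEE W q μ (x, t) - QEE W q μ (x, η) ≤
        (1 - μ.real {z | phi W q (z - x) ≤ t}) * (η - t) := by
      rw [← he]
      unfold QEE
      rw [← integral_sub (integrable_excess hf hμ _) (integrable_excess hf hμ _)]
      exact integral_mono ((integrable_excess hf hμ _).sub (integrable_excess hf hμ _)) hi
        fun z => max_sub_sub_max_le hle
    have ht : 1 - α ≤ μ.real {z | phi W q (z - x) ≤ t} := ht
    have h2 : QEE W q μ (x, t) - QEE W q μ (x, η) ≤ α * (η - t) :=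
      h1.trans (mul_le_mul_of_nonneg_right (by linarith) (by linarith))
    have h3 := mul_le_mul_of_nonneg_left h2 (one_div_pos.2 hα0).le
    rw [← mul_assoc, one_div_mul_cancel hα0.ne'] at h3
    linarith
  have hdown : ∀ t, t ∉ T → η ≤ t →
      t + 1 / α * QEE W q μ (x, t) ≤ η + 1 / α * QEE W q μ (x, η) := by
    intro t ht hle
    obtain ⟨hi, he⟩ := integral_indicator_phi (μ := μ) hf x t (t - η)
    have h1 : (1 - μ.real {z | phi W q (z - x) ≤ t}) * (t - η) ≤
        QEE W q μ (x, η) - QEE W q μ (x, t) := by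
      rw [← he]
      unfold QEE
      rw [← integral_sub (integrable_excess hf hμ _) (integrable_excess hf hμ _)]
      exact integral_mono hi ((integrable_excess hf hμ _).sub (integrable_excess hf hμ _))
        fun z => le_max_sub_sub_max hle
    have ht : μ.real {z | phi W q (z - x) ≤ t} < 1 - α := not_le.1 ht
    have h2 : α * (t - η) ≤ QEE W q μ (x, η) - QEE W q μ (x, t) :=
      (mul_le_mul_of_nonneg_right (by linarith) (by linarith)).trans h1
    have h3 := mul_le_mul_of_nonneg_left h2 (one_div_pos.2 hα0).le
    rw [← mul_assoc, one_div_mul_cancel hα0.ne'] at h3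
    linarith
  -- Approach v from inside (v, η) or (η, v), where membership in T is known, and pass to the limit
  -- by continuity of Q_EE; attainment of the infimum is not needed.
  rcases lt_trichotomy v η with hlt | heq | hlt
  · refine le_of_tendsto (hg.continuousAt.tendsto.mono_left (nhdsWithin_le_nhds (s := Set.Ioi v)))
      ((Filter.eventually_of_mem (Ioo_mem_nhdsGT hlt)) fun t ht => hup t ?_ ht.2.le)
    obtain ⟨t', ht', hlt'⟩ := exists_lt_of_csInf_lt hne (hvT ▸ ht.1)
    exact hmono t' ht' t hlt'.le
  · rw [heq]
  · refine le_of_tendsto (hg.continuousAt.tendsto.mono_left (nhdsWithin_le_nhds (s := Set.Iio v)))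
      ((Filter.eventually_of_mem (Ioo_mem_nhdsLT hlt)) fun t ht => hdown t ?_ ht.1.le)
    exact notMem_of_lt_csInf (hvT ▸ ht.2) hbdd

theorem QCVaR_le (hf : IsLipschitzSublinear (phi W q) L)
    (hμ : Integrable (fun z : E s => ‖z‖) μ) {α : ℝ} (hα0 : 0 < α) (hα1 : α < 1) (x : E s)
    (η : ℝ) : QCVaR W q μ α x ≤ η + 1 / α * QEE W q μ (x, η) :=
  ciInf_le ⟨_, by rintro _ ⟨η, rfl⟩; exact QVaR_add_QEE_le hf hμ hα0 hα1 x η⟩ η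

theorem QCVaR_eq (hf : IsLipschitzSublinear (phi W q) L)
    (hμ : Integrable (fun z : E s => ‖z‖) μ) {α : ℝ} (hα0 : 0 < α) (hα1 : α < 1) (x : E s) :
    QCVaR W q μ α x = QVaR W q μ α x + 1 / α * QEE W q μ (x, QVaR W q μ α x) :=
  le_antisymm (QCVaR_le hf hμ hα0 hα1 x _)
    (le_ciInf fun η => QVaR_add_QEE_le hf hμ hα0 hα1 x η)

/-- Apply the modulus to the graph of the VaR over V. At the intermediate point, the convex
combination of the two VaR values is merely a candidate for η, and this bounds the CVaR from above.
-/
theorem IsPartialModulus.strongConvexOn_QCVaR (hf : IsLipschitzSublinear (phi W q) L)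
    (hμ : Integrable (fun z : E s => ‖z‖) μ) {V : Set (E s)} (hV : Convex ℝ V) {η₀ δ κ α : ℝ}
    (hκ : IsPartialModulus W q μ V η₀ δ κ) (hα0 : 0 < α) (hα1 : α < 1)
    (hle : ∀ x ∈ V, QVaR W q μ α x ≤ η₀)
    (hLip : ∀ x ∈ V, ∀ y ∈ V, |QVaR W q μ α y - QVaR W q μ α x| ≤ δ / 3 * ‖y - x‖) :
    StrongConvexOn V (κ / α) (QCVaR W q μ α) := by
  refine ⟨hV, fun x hx y hy a b ha hb hab => ?_⟩
  rcases ha.eq_or_lt with rfl | ha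
  · obtain rfl : b = 1 := by linarith
    simp
  rcases hb.eq_or_lt with rfl | hb
  · obtain rfl : a = 1 := by linarith
    simp
  obtain rfl : b = 1 - a := by linarith
  have hadm : IsAdmissible W q V η₀ δ ((fun x => (x, QVaR W q μ α x)) '' V) := by
    constructor
    · rintro _ ⟨x, hx, rfl⟩
      exact ⟨hx, hle x hx⟩
    · rintro _ ⟨x, hx, rfl⟩ _ ⟨y, hy, rfl⟩ d - -
      have := (abs_le.1 (hLip x hx y hy)).1
      simpa only [neg_mul] using this
  have h1 := hκ _ hadm _ ⟨x, hx, rfl⟩ _ ⟨y, hy, rfl⟩ a ha (by linarith)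
  have h2 := QCVaR_le hf hμ hα0 hα1 (a • x + (1 - a) • y)
    (a * QVaR W q μ α x + (1 - a) * QVaR W q μ α y)
  simp only [Prod.smul_mk, Prod.mk_add_mk, smul_eq_mul] at h1
  have h3 := mul_le_mul_of_nonneg_left h1 (one_div_pos.2 hα0).le
  simp only [smul_eq_mul]
  rw [QCVaR_eq hf hμ hα0 hα1 x, QCVaR_eq hf hμ hα0 hα1 y]
  refine (h2.trans (add_le_add_right h3 _)).trans (le_of_eq ?_)
  ring

end ExpectedExcess

end TwoStage

end

theorem mainTheorem7 {s m : ℕ} (W : Matrix (Fin s) (Fin m) ℝ) (q : Fin m → ℝ)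
    (hA1 : TwoStage.CompleteRecourse W) (hA2 : TwoStage.ExpensiveRecourse W q)
    (r ρ η₀ δ : ℝ) (hr : 0 < r) (hρ : 0 < ρ) (hη₀ : 0 < η₀)
    (hA5 : TwoStage.ThresholdCondition W q η₀ ρ)
    (hδ : TwoStage.IsDelta W q δ) :
    ∃ κ : ℝ, 0 < κ ∧
      ∀ (V : Set (TwoStage.E s)) (μ : Measure (TwoStage.E s)) [IsProbabilityMeasure μ],
        Convex ℝ V → IsOpen V →
        Integrable (fun z : TwoStage.E s => ‖z‖) μ →
        TwoStage.DensityCondition μ V r ρ →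
        TwoStage.IsPartialModulus W q μ V η₀ δ κ ∧
        ∀ α : ℝ, 0 < α → α < 1 →
          (∀ x ∈ V, TwoStage.QVaR W q μ α x ≤ η₀) →
          (∀ x ∈ V, ∀ y ∈ V,
            |TwoStage.QVaR W q μ α y - TwoStage.QVaR W q μ α x| ≤ δ / 3 * ‖y - x‖) →
          StrongConvexOn V (κ / α) (TwoStage.QCVaR W q μ α) ∧
          ∀ κ' : ℝ, TwoStage.IsPartialModulus W q μ V η₀ δ κ' →
            StrongConvexOn V (κ' / α) (TwoStage.QCVaR W q μ α) := by
  obtain ⟨L, hf⟩ := TwoStage.exists_isLipschitzSublinear_phi hA1 hA2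
  obtain ⟨κ, hκ, H⟩ := TwoStage.exists_isPartialModulus hA1 hA2 hr hρ hη₀ hA5 hδ
  refine ⟨κ, hκ, fun V μ _ hV _ hμ hd => ⟨H V μ hV hμ hd, fun α hα0 hα1 hle hLip => ?_⟩⟩
  exact ⟨(H V μ hV hμ hd).strongConvexOn_QCVaR hf hμ hV hα0 hα1 hle hLip,
    fun κ' hκ' => hκ'.strongConvexOn_QCVaR hf hμ hV hα0 hα1 hle hLip⟩
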